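/- **Setting.** Let $n\ge 0$, $m\ge 1$ and let $\Delta_1,\dots,\Delta_m\subseteq[n]$ satisfy $\Delta_1\cup\dots\cup\Delta_m=[n]$. Write $\mathbb R[x_{\Delta_i}]$ for the polynomials in $\mathbb R[x]=\mathbb R[x_1,\dots,x_n]$ in which only the variables $x_j$, $j\in\Delta_i$, occur. For each $i$ let $f_i\in\mathbb R[x_{\Delta_i}]$ and let $G_i$ be a symmetric $\ell_i\times\ell_i$ matrix with entries in $\mathbb R[x_{\Delta_i}]$. Consider $$\min_{x\in\mathbb R^n}\ f(x):=f_1(x_{\Delta_1})+\dots+f_m(x_{\Delta_m})\quad\text{s.t.}\quad G_i(x_{\Delta_i})\succeq 0,\ i=1,\dots,m, \tag{P}$$ with minimum value $f_{\min}$. The degree of a matrix or vector of polynomials is the maximum of the degrees of its entries, and the zero polynomial is given degree $0$. Put $k_0:=\max_{i}\max(\lceil\deg (f)/2\rceil,\lceil\deg (G_i)/2\rceil)$. Slater's condition says that some $x\in\mathbb R^n$ has $G_i(x_{\Delta_i})\succ 0$ for all $i$. A polynomial $p$ is SOS-convex if $\nabla^2p=Q^TQ$ for some matrix polynomial $Q$.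 A symmetric matrix polynomial $G$ is SOS-concave if, for every real vector $\xi$, the polynomial $-\xi^TG\xi$ is SOS-convex ($Q$ may depend on $\xi$). Let $\Sigma[x_{\Delta_i}]_{2k}$ be the set of sums of squares of polynomials in $\mathbb R[x_{\Delta_i}]$ that have degree at most $2k$, and let $$\mathrm{QM}_{\Delta_i}[G_i]_{2k}:=\Sigma[x_{\Delta_i}]_{2k}+\Big\{\sum_{j=1}^sP_j^TG_iP_j:\ s\in\mathbb N,\ P_j\in\mathbb R[x_{\Delta_i}]^{\ell_i},\ 2\deg (P_j)+\deg (G_i)\le 2k\Big\},$$ $\mathrm{QM}[G]_{spa,2k}:=\sum_{i=1}^m\mathrm{QM}_{\Delta_i}[G_i]_{2k}$. The optimal value of the $k$th order sparse SOS relaxation is $$f_k^{spa}:=\sup\{\gamma\in\mathbb R:\ f-\gamma\in\mathrm{QM}[G]_{spa,2k}\}.$$ Let $\mathbb N^{\Delta_i}_d:=\{\alpha\in\mathbb N^n:\ |\alpha|\le d,\ \alpha_j=0\text{ for }j\notin\Delta_i\}$ and $\mathbb U_k:=\bigcup_i\mathbb N^{\Delta_i}_{2k}$. For $y\in\mathbb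 R^{\mathbb U_k}$ let $y_{\Delta_i}:=(y_\alpha)_{\alpha\in\mathbb N^{\Delta_i}_{2k}}$. For $p=\sum_\alpha p_\alpha x^\alpha\in\mathbb R[x_{\Delta_i}]$ put $\langle p,y_{\Delta_i}\rangle:=\sum_{\alpha\in\mathbb N^{\Delta_i}_{2k}}p_\alpha y_\alpha$. Let $$M^{(k)}_{\Delta_i}[y_{\Delta_i}]:=(y_{\alpha+\beta})_{\alpha,\beta\in\mathbb N^{\Delta_i}_k},$$ and let $L^{(k)}_{G_i}[y_{\Delta_i}]$ be the $\ell_i\times\ell_i$ block matrix whose $(a,b)$ block is $\big(\langle (G_i)_{ab}\,x^{\alpha+\beta},y_{\Delta_i}\rangle\big)_{\alpha,\beta\in\mathbb N^{\Delta_i}_{s}}$, where $s=\lfloor k-\deg (G_i)/2\rfloor$. The $k$th order sparse moment relaxation is to minimize $$\langle f,y\rangle:=\sum_{i=1}^m\langle f_i,y_{\Delta_i}\rangle$$ over all $y\in\mathbb R^{\mathbb U_k}$ with $y_0=1$ and $L^{(k)}_{G_i}[y_{\Delta_i}]\succeq0$, $M^{(k)}_{\Delta_i}[y_{\Delta_i}]\succeq0$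 for $i=1,\dots,m$. Its optimal value (infimum) is $f_k^{smo}$. **Theorem.** Suppose that (P) has a minimizer, that each $f_i$ is SOS-convex and that each $G_i$ is SOS-concave. Then: (i) For every integer $k\ge k_0$ we have $f_k^{smo}=f_{\min}$. If moreover Slater's condition holds, then for every $k\ge k_0$ also $f_k^{spa}=f_{\min}$ and $f-f_{\min}\in\mathrm{QM}[G]_{spa,2k}$. (ii) For every integer $k\ge\max(k_0,1)$ and every minimizer $y^*$ of the $k$th order sparse moment relaxation, the point $x^*:=(y^*_{e_1},\dots,y^*_{e_n})$ is a minimizer of (P), where $e_j$ denotes the $j$th unit vector of $\mathbb N^n$. -/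

import Mathlib

open MvPolynomial

noncomputable section

/-- The monomial powers `α ∈ ℕⁿ` of degree at most `d` in which only the variables of `Δ` occur. -/
def monPowers {n : ℕ} (Δ : Finset (Fin n)) (d : ℕ) : Finset (Fin n →₀ ℕ) :=
  (Finset.range (d + 1)).biUnion fun j => Finset.finsuppAntidiag Δ j

theorem mem_monPowers {n : ℕ} {Δ : Finset (Fin n)} {d : ℕ} {α : Fin n →₀ ℕ} :
    α ∈ monPowers Δ d ↔ α.support ⊆ Δ ∧ α.degree ≤ d := by
  simp only [monPowers, Finset.mem_biUnion, Finset.mem_range, Finset.mem_finsuppAntidiag]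
  constructor
  · rintro ⟨j, hj, hs, hsub⟩
    refine ⟨hsub, ?_⟩
    have h : α.degree = Δ.sum α := by
      rw [Finsupp.degree_apply]
      exact Finset.sum_subset hsub fun i _ hi => Finsupp.notMem_support_iff.mp hi
    omega
  · rintro ⟨hsub, hd⟩
    refine ⟨α.degree, by omega, ?_, hsub⟩
    rw [Finsupp.degree_apply]
    exact (Finset.sum_subset hsub fun i _ hi => Finsupp.notMem_support_iff.mp hi).symm

/-- The degree of a polynomial vector: the maximum of the degrees of its entries. -/
def vecDeg {n ℓ : ℕ} (P : Fin ℓ → MvPolynomial (Fin n) ℝ) : ℕ :=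
  Finset.univ.sup fun a => (P a).totalDegree

/-- The degree of a matrix polynomial: the maximum of the degrees of its entries. -/
def matDeg {n ℓ : ℕ} (G : Matrix (Fin ℓ) (Fin ℓ) (MvPolynomial (Fin n) ℝ)) : ℕ :=
  Finset.univ.sup fun a => Finset.univ.sup fun b => (G a b).totalDegree

/-- The Hessian matrix of a polynomial, as a matrix polynomial. -/
def polyHessian {n : ℕ} (p : MvPolynomial (Fin n) ℝ) :
    Matrix (Fin n) (Fin n) (MvPolynomial (Fin n) ℝ) :=
  Matrix.of fun s t => pderiv s (pderiv t p)

/-- A polynomial `p` is SOS-convex if `∇² p = QᵀQ` for some matrix polynomial `Q`.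
For a polynomial in the variables of `Δ` only, it makes no difference whether the Hessian and `Q`
are taken in these variables or in all of them: the other rows and columns of the Hessian vanish,
and the other variables can be set to zero in `Q`. -/
def IsSOSConvex {n : ℕ} (p : MvPolynomial (Fin n) ℝ) : Prop :=
  ∃ (s : ℕ) (Q : Matrix (Fin s) (Fin n) (MvPolynomial (Fin n) ℝ)),
    polyHessian p = Q.transpose * Q

/-- The scalar polynomial `ξᵀ G(x) ξ`. -/
def quadForm {n ℓ : ℕ} (G : Matrix (Fin ℓ) (Fin ℓ) (MvPolynomial (Fin n) ℝ)) (ξ : Fin ℓ → ℝ) :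
    MvPolynomial (Fin n) ℝ :=
  ∑ a, ∑ b, C (ξ a * ξ b) * G a b

/-- A matrix polynomial `G` is SOS-convex if for every real vector `ξ` there is a matrix polynomial
`Q`, which may depend on `ξ`, with `∇² (ξᵀ G ξ) = QᵀQ`. -/
def IsSOSConvexMat {n ℓ : ℕ} (G : Matrix (Fin ℓ) (Fin ℓ) (MvPolynomial (Fin n) ℝ)) : Prop :=
  ∀ ξ : Fin ℓ → ℝ, IsSOSConvex (quadForm G ξ)

/-- A matrix polynomial `G` is SOS-concave if `-G` is SOS-convex. -/
def IsSOSConcaveMat {n ℓ : ℕ} (G : Matrix (Fin ℓ) (Fin ℓ) (MvPolynomial (Fin n) ℝ)) : Prop :=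
  IsSOSConvexMat (-G)

/-- The truncated cone `Σ[x_Δ]_{2k}`: the polynomials of degree at most `2k` that are sums of
squares of polynomials in the variables of `Δ`. -/
def sosTrunc {n : ℕ} (Δ : Finset (Fin n)) (k : ℕ) : Set (MvPolynomial (Fin n) ℝ) :=
  {σ | σ.totalDegree ≤ 2 * k ∧
    ∃ (r : ℕ) (p : Fin r → MvPolynomial (Fin n) ℝ),
      (∀ j, p j ∈ supported ℝ (Δ : Set (Fin n))) ∧ σ = ∑ j, p j ^ 2}

/-- The truncated quadratic module `QM_Δ[G]_{2k}`: the polynomials `σ + ∑ⱼ Pⱼᵀ G Pⱼ` with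
`σ ∈ Σ[x_Δ]_{2k}` and polynomial vectors `Pⱼ` in the variables of `Δ` such that
`2 deg Pⱼ + deg G ≤ 2k`. -/
def qmTrunc {n ℓ : ℕ} (Δ : Finset (Fin n))
    (G : Matrix (Fin ℓ) (Fin ℓ) (MvPolynomial (Fin n) ℝ)) (k : ℕ) :
    Set (MvPolynomial (Fin n) ℝ) :=
  {q | ∃ σ ∈ sosTrunc Δ k, ∃ (r : ℕ) (P : Fin r → Fin ℓ → MvPolynomial (Fin n) ℝ),
    (∀ j a, P j a ∈ supported ℝ (Δ : Set (Fin n))) ∧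
    (∀ j, 2 * vecDeg (P j) + matDeg G ≤ 2 * k) ∧
    q = σ + ∑ j, ∑ a, ∑ b, P j a * G a b * P j b}

/-- The Riesz functional `⟨p, z⟩ = ∑_α p_α z_α` of a truncated multi-sequence `z` of degree `d` in
the variables of `Δ`. -/
def riesz {n : ℕ} {Δ : Finset (Fin n)} {d : ℕ} (z : monPowers Δ d → ℝ)
    (p : MvPolynomial (Fin n) ℝ) : ℝ :=
  ∑ α : monPowers Δ d, coeff α.1 p * z α

/-- The matrix `𝓛_z (p · [x_Δ]_s [x_Δ]_sᵀ)`, the Riesz functional being applied entrywise. -/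
def locBlock {n : ℕ} {Δ : Finset (Fin n)} {d : ℕ} (s : ℕ) (z : monPowers Δ d → ℝ)
    (p : MvPolynomial (Fin n) ℝ) : Matrix (monPowers Δ s) (monPowers Δ s) ℝ :=
  Matrix.of fun α β => riesz z (p * (monomial α.1 1 * monomial β.1 1))

/-- The moment matrix `M_Δ^{(k)}[z]`. -/
def momentMatrix {n : ℕ} {Δ : Finset (Fin n)} (k : ℕ) (z : monPowers Δ (2 * k) → ℝ) :
    Matrix (monPowers Δ k) (monPowers Δ k) ℝ :=
  locBlock k z 1

/-- The localizing matrix `L_G^{(k)}[z]`: the block matrix whose `(a, b)` block is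
`𝓛_z (G_{ab} · [x_Δ]_s [x_Δ]_sᵀ)` with `s = ⌊k - deg G / 2⌋`. It is used for `deg G ≤ 2k` only. -/
def localizingMatrix {n ℓ : ℕ} {Δ : Finset (Fin n)} (k : ℕ)
    (G : Matrix (Fin ℓ) (Fin ℓ) (MvPolynomial (Fin n) ℝ)) (z : monPowers Δ (2 * k) → ℝ) :
    Matrix (Fin ℓ × monPowers Δ ((2 * k - matDeg G) / 2))
      (Fin ℓ × monPowers Δ ((2 * k - matDeg G) / 2)) ℝ :=
  Matrix.of fun u v => locBlock ((2 * k - matDeg G) / 2) z (G u.1 v.1) u.2 v.2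

/-- The data of a sparse matrix polynomial optimization problem: minimize
`f₁(x_{Δ₁}) + ⋯ + f_m(x_{Δ_m})` over `x ∈ ℝⁿ` subject to `G_i(x_{Δ_i}) ⪰ 0` for all `i`. Polynomials
in `x_{Δ_i}` are the elements of `ℝ[x]` in which only the variables of `Δ_i` occur. -/
structure SparseMatPOP (n m : ℕ) where
  /-- There is at least one block. -/
  m_pos : 0 < m
  /-- The blocks of variables. -/
  Δ : Fin m → Finset (Fin n)
  /-- The blocks cover all variables. -/
  cover : ∀ j, ∃ i, j ∈ Δ i
  /-- The summands of the objective. -/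
  fs : Fin m → MvPolynomial (Fin n) ℝ
  fs_mem : ∀ i, fs i ∈ supported ℝ (Δ i : Set (Fin n))
  /-- The sizes of the constraining matrices. -/
  ℓ : Fin m → ℕ
  /-- The constraining matrix polynomials. -/
  G : ∀ i, Matrix (Fin (ℓ i)) (Fin (ℓ i)) (MvPolynomial (Fin n) ℝ)
  G_symm : ∀ i, (G i).IsSymm
  G_mem : ∀ i a b, G i a b ∈ supported ℝ (Δ i : Set (Fin n))

namespace SparseMatPOP

variable {n m : ℕ} (P : SparseMatPOP n m)

/-- The objective `f = f₁ + ⋯ + f_m`. -/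
def f : MvPolynomial (Fin n) ℝ := ∑ i, P.fs i

/-- The real symmetric matrix `G_i(x)`. -/
def Gval (i : Fin m) (x : Fin n → ℝ) : Matrix (Fin (P.ℓ i)) (Fin (P.ℓ i)) ℝ :=
  (P.G i).map (eval x)

/-- The feasible set `K`. -/
def K : Set (Fin n → ℝ) := {x | ∀ i, (P.Gval i x).PosSemidef}

/-- `u` is a (global) minimizer of the problem. -/
def IsMinimizer (u : Fin n → ℝ) : Prop := u ∈ P.K ∧ ∀ x ∈ P.K, eval u P.f ≤ eval x P.f

/-- The minimum value of the problem. It is used only when a minimizer exists. -/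
def fmin : ℝ := sInf ((fun x => eval x P.f) '' P.K)

/-- Slater's condition. -/
def Slater : Prop := ∃ x : Fin n → ℝ, ∀ i, (P.Gval i x).PosDef

/-- The smallest relaxation order: the maximum of `⌈deg f / 2⌉` and of all `⌈deg G_i / 2⌉`. -/
def k₀ : ℕ :=
  max ((P.f.totalDegree + 1) / 2) (Finset.univ.sup fun i => (matDeg (P.G i) + 1) / 2)

/-- The sparse truncated quadratic module
`QM[G]_{spa,2k} = QM_{Δ₁}[G₁]_{2k} + ⋯ + QM_{Δ_m}[G_m]_{2k}`. -/
def qmSpa (k : ℕ) : Set (MvPolynomial (Fin n) ℝ) :=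
  {q | ∃ r : Fin m → MvPolynomial (Fin n) ℝ,
    (∀ i, r i ∈ qmTrunc (P.Δ i) (P.G i) k) ∧ q = ∑ i, r i}

/-- The optimal value of the `k`th order sparse SOS relaxation, the supremum of all real `γ` with
`f - γ ∈ QM[G]_{spa,2k}`. -/
def fspa (k : ℕ) : EReal := ⨆ γ ∈ {γ : ℝ | P.f - C γ ∈ P.qmSpa k}, (γ : EReal)

/-- The set `𝕌_k` of monomial powers of degree at most `2k` in the variables of some block. -/
def U (k : ℕ) : Finset (Fin n →₀ ℕ) :=
  Finset.univ.biUnion fun i => monPowers (P.Δ i) (2 * k)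

variable {P}

theorem mem_U_of_mem {k : ℕ} (i : Fin m) {α : Fin n →₀ ℕ} (h : α ∈ monPowers (P.Δ i) (2 * k)) :
    α ∈ P.U k :=
  Finset.mem_biUnion.mpr ⟨i, Finset.mem_univ i, h⟩

theorem zero_mem_U (k : ℕ) : (0 : Fin n →₀ ℕ) ∈ P.U k :=
  mem_U_of_mem ⟨0, P.m_pos⟩ (mem_monPowers.mpr (by simp))

theorem single_mem_U {k : ℕ} (hk : 1 ≤ k) (j : Fin n) : Finsupp.single j 1 ∈ P.U k := by
  obtain ⟨i, hi⟩ := P.cover j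
  refine mem_U_of_mem i (mem_monPowers.mpr ⟨?_, ?_⟩)
  · exact Finsupp.support_single_subset.trans (Finset.singleton_subset_iff.mpr hi)
  · rw [Finsupp.degree_single]
    omega

/-- The subvector `y_{Δ_i}` of `y ∈ ℝ^{𝕌_k}`. -/
def sub {k : ℕ} (y : P.U k → ℝ) (i : Fin m) : monPowers (P.Δ i) (2 * k) → ℝ :=
  fun α => y ⟨α.1, mem_U_of_mem i α.2⟩

/-- The objective `⟨f, y⟩ = ⟨f₁, y_{Δ₁}⟩ + ⋯ + ⟨f_m, y_{Δ_m}⟩` of the moment relaxation. -/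
def momObj {k : ℕ} (y : P.U k → ℝ) : ℝ := ∑ i, riesz (sub y i) (P.fs i)

variable (P)

/-- The feasible set of the `k`th order sparse moment relaxation. -/
def momFeasible (k : ℕ) : Set (P.U k → ℝ) :=
  {y | (∀ i, (localizingMatrix k (P.G i) (sub y i)).PosSemidef) ∧
    (∀ i, (momentMatrix k (sub y i)).PosSemidef) ∧
    y ⟨0, zero_mem_U k⟩ = 1}

/-- The optimal value of the `k`th order sparse moment relaxation. -/
def fsmo (k : ℕ) : EReal := ⨅ y ∈ P.momFeasible k, (momObj y : EReal)

variable {P}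

/-- `y` is a minimizer of the `k`th order sparse moment relaxation. -/
def IsMomMinimizer {k : ℕ} (y : P.U k → ℝ) : Prop :=
  y ∈ P.momFeasible k ∧ ∀ z ∈ P.momFeasible k, momObj y ≤ momObj z

/-- The point `(y_{e₁}, …, y_{eₙ})` of first-order moments, which exists for `k ≥ 1`. -/
def firstMoments {k : ℕ} (hk : 1 ≤ k) (y : P.U k → ℝ) : Fin n → ℝ :=
  fun j => y ⟨Finsupp.single j 1, single_mem_U hk j⟩

end SparseMatPOP

end

noncomputable section

namespace SOSConvexity

variable {n : ℕ}

/-! Everything rests on one fact: an SOS-convex `p` exceeds its tangent at any `u` by a sum of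
squares. By Taylor's formula the difference is the integral over `[0,1]` of `(1 - t) (x-u)ᵀ ∇²p(u +
t(x-u)) (x-u)`. The integrand is the weight `1 - t` times a sum of squares of polynomials in `t`,
and integration keeps it a sum of squares because the moment matrix of the weight is positive
semidefinite (`weightedIntegral_sq`, `isSOSIn_taylorRem`). Leading terms of squares cannot cancel,
so degrees stay under control (`totalDegree_le_of_sum_sq`).

Moment side: a feasible `y` is nonnegative on sums of squares. Applied to Taylor remainders at the
first moments `x*`, this is Jensen's inequality `p(x*) ≤ ⟨p, y⟩` (`eval_le_riesz`). Taking `p =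
-ξᵀG_iξ` shows that `x*` is feasible, and `p = f_i` that `f(x*) ≤ ⟨f, y⟩`. The blocks read their
first moments from the same `y`, so they define one common point. Conversely, feasible points give
feasible moment sequences.

SOS side: Slater's condition yields positive semidefinite multipliers, written as sums of rank-one
terms, for which the Lagrangian `L` is nonnegative on `ℝⁿ` and vanishes at the minimizer `u`
(`exists_lagrange_multipliers`). Then `∇L(u) = 0`, so `L` is its own Taylor remainder at `u`. The
remainder is linear in the polynomial, hence `L` splits into blockwise remainders of `f_i` and of
`-ξᵀG_iξ`, all of them sums of squares (`f_sub_fmin_mem_qmSpa`). -/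

/-! ### Leading forms of sums of squares -/

theorem homogeneousComponent_two_mul_sq (p : MvPolynomial (Fin n) ℝ) {d : ℕ} (hd : 0 < d)
    (hp : p.totalDegree ≤ d) :
    homogeneousComponent (2 * d) (p ^ 2) = homogeneousComponent d p ^ 2 := by
  set c := homogeneousComponent d p with hc
  have hcd : c.totalDegree ≤ d := (homogeneousComponent_isHomogeneous d p).totalDegree_le
  have hr : (p - c).totalDegree < d := by
    refine (Finset.sup_lt_iff (bot_lt_iff_ne_bot.2 hd.ne')).2 fun m hm => ?_
    change m.degree < d
    have h1 : coeff m (p - c) ≠ 0 := mem_support_iff.1 hm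
    by_contra hlt
    apply h1
    rw [coeff_sub, hc, coeff_homogeneousComponent]
    split_ifs with h
    · simp
    · rw [coeff_eq_zero_of_totalDegree_lt, sub_zero]
      change p.totalDegree < m.degree
      omega
  have hsplit : p ^ 2 = c ^ 2 + (p - c) * (p + c) := by ring
  have hlow : ((p - c) * (p + c)).totalDegree < 2 * d := by
    have h1 := totalDegree_mul (p - c) (p + c)
    have h2 := totalDegree_add p c
    have h3 : max p.totalDegree c.totalDegree ≤ d := max_le hp hcd
    omega
  rw [hsplit, map_add, homogeneousComponent_eq_zero _ _ hlow, add_zero]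
  have hh : (c ^ 2).IsHomogeneous (2 * d) := by
    have := (homogeneousComponent_isHomogeneous d p).pow 2
    rwa [mul_comm] at this
  rw [homogeneousComponent_of_mem hh, if_pos rfl]

/-- There is no cancellation of leading terms in a sum of squares of real polynomials. -/
theorem totalDegree_le_of_sum_sq {ι : Type*} (s : Finset ι) (p : ι → MvPolynomial (Fin n) ℝ)
    {k : ℕ} (h : (∑ j ∈ s, p j ^ 2).totalDegree ≤ 2 * k) : ∀ j ∈ s, (p j).totalDegree ≤ k := by
  by_contra! hcon
  obtain ⟨j₁, hj₁, hk⟩ := hcon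
  -- With `d > k` the largest degree, the part of degree `2d` of the sum is the sum of the squared
  -- degree-`d` parts. It is zero, so each of these parts vanishes at every real point.
  obtain ⟨j₀, hj₀, hmax⟩ := s.exists_max_image (fun j => (p j).totalDegree) ⟨j₁, hj₁⟩
  set d := (p j₀).totalDegree with hd
  have hkd : k < d := hk.trans_le (hmax j₁ hj₁)
  have hzero : ∑ j ∈ s, homogeneousComponent d (p j) ^ 2 = 0 := by
    rw [← homogeneousComponent_eq_zero (2 * d) (∑ j ∈ s, p j ^ 2) (by omega), map_sum]
    exact Finset.sum_congr rfl fun j hj =>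
      (homogeneousComponent_two_mul_sq _ (by omega) (hmax j hj)).symm
  have hc : homogeneousComponent d (p j₀) = 0 := by
    refine MvPolynomial.funext fun x => ?_
    have := congrArg (eval x) hzero
    simp only [map_sum, map_pow, map_zero] at this
    have := (Finset.sum_eq_zero_iff_of_nonneg fun j _ => sq_nonneg _).1 this j₀ hj₀
    simpa using this
  have hne : p j₀ ≠ 0 := by
    rintro h0
    rw [h0, totalDegree_zero] at hd
    omega
  obtain ⟨m, hm, hmd⟩ := Finset.exists_mem_eq_sup _ (support_nonempty.2 hne) fun m => m.degree
  have := congrArg (coeff m) hc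
  rw [coeff_homogeneousComponent, if_pos, coeff_zero] at this
  · exact mem_support_iff.1 hm this
  · exact hmd.symm

/-! ### Chain rule, and moments of the weight `1 - t` -/

/-- The chain rule along a line, in an arbitrary commutative algebra of coefficients. -/
theorem derivative_aeval {A : Type*} [CommRing A] [Algebra ℝ A]
    (w : Fin n → Polynomial A) (p : MvPolynomial (Fin n) ℝ) :
    Polynomial.derivative (aeval w p) =
      ∑ s, aeval w (pderiv s p) * Polynomial.derivative (w s) := by
  induction p using MvPolynomial.induction_on with
  | C a => simp [Polynomial.algebraMap_apply]
  | add p q hp hq => simp [hp, hq, add_mul, Finset.sum_add_distrib]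
  | mul_X p i hp =>
    have h1 : ∑ s, aeval w (pderiv s (X i : MvPolynomial (Fin n) ℝ)) *
        Polynomial.derivative (w s) = Polynomial.derivative (w i) := by
      rw [Finset.sum_eq_single i]
      · simp
      · intro b _ hb
        rw [pderiv_X_of_ne hb.symm, map_zero, zero_mul]
      · simp
    have h2 : ∀ s, aeval w (pderiv s (p * X i)) * Polynomial.derivative (w s) =
        w i * (aeval w (pderiv s p) * Polynomial.derivative (w s)) +
        aeval w p * (aeval w (pderiv s (X i : MvPolynomial (Fin n) ℝ)) *
          Polynomial.derivative (w s)) := by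
      intro s
      rw [pderiv_mul, map_add, map_mul, map_mul, aeval_X]
      ring
    simp only [h2]
    rw [Finset.sum_add_distrib, ← Finset.mul_sum, ← Finset.mul_sum, h1, ← hp, map_mul, aeval_X,
      Polynomial.derivative_mul]
    ring

/-- The moment matrix of the measure `(1 - t) dt` on the unit interval is positive semidefinite. -/
theorem posSemidef_intervalMoment (N : ℕ) :
    (Matrix.of fun k l : Fin N => (1 / ((k + l + 1) * (k + l + 2)) : ℝ)).PosSemidef := by
  refine Matrix.PosSemidef.of_dotProduct_mulVec_nonneg ?_ fun x => ?_
  · ext k l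
    simp [add_comm (k : ℝ)]
  · have hint : ∀ k l : Fin N, ∫ t in (0 : ℝ)..1, (1 - t) * (t ^ (k + l : ℕ)) =
        1 / ((k + l + 1) * (k + l + 2)) := by
      intro k l
      have : ∀ t : ℝ, (1 - t) * (t ^ (k + l : ℕ)) = t ^ (k + l : ℕ) - t ^ (k + l + 1 : ℕ) := by
        intro t; ring
      simp only [this]
      rw [intervalIntegral.integral_sub (by simp) (by simp), integral_pow, integral_pow]
      push_cast
      have h1 : (k + l + 1 : ℝ) ≠ 0 := by positivity
      have h2 : (k + l + 2 : ℝ) ≠ 0 := by positivity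
      have h3 : (k + l + 1 + 1 : ℝ) ≠ 0 := by positivity
      simp
      field_simp
      ring
    -- The quadratic form at `x` is the weighted integral of the square of `∑ x_k t^k`.
    have hsq : ∫ t in (0 : ℝ)..1, (1 - t) * (∑ k, x k * t ^ (k : ℕ)) ^ 2 =
        ∑ k, ∑ l, x k * x l * (1 / ((k + l + 1) * (k + l + 2))) := by
      have : ∀ t : ℝ, (1 - t) * (∑ k, x k * t ^ (k : ℕ)) ^ 2 =
          ∑ k, ∑ l, x k * x l * ((1 - t) * (t ^ (k + l : ℕ))) := by
        intro t
        rw [sq, Finset.sum_mul_sum, Finset.mul_sum]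
        refine Finset.sum_congr rfl fun k _ => ?_
        rw [Finset.mul_sum]
        exact Finset.sum_congr rfl fun l _ => by ring
      simp only [this]
      rw [intervalIntegral.integral_finsetSum]
      · refine Finset.sum_congr rfl fun k _ => ?_
        rw [intervalIntegral.integral_finsetSum]
        · refine Finset.sum_congr rfl fun l _ => ?_
          rw [intervalIntegral.integral_const_mul, hint]
        · intro l _
          exact Continuous.intervalIntegrable (by fun_prop) _ _
      · intro k _
        exact Continuous.intervalIntegrable (by fun_prop) _ _
    have hnn : 0 ≤ ∫ t in (0 : ℝ)..1, (1 - t) * (∑ k, x k * t ^ (k : ℕ)) ^ 2 :=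
      intervalIntegral.integral_nonneg zero_le_one fun t ht =>
        mul_nonneg (by linarith [ht.2]) (sq_nonneg _)
    rw [hsq] at hnn
    refine hnn.trans_eq ?_
    simp only [dotProduct, Matrix.mulVec, Matrix.of_apply, star_trivial, Finset.mul_sum]
    exact Finset.sum_congr rfl fun k _ => Finset.sum_congr rfl fun l _ => by ring

open scoped MatrixOrder in
theorem exists_transpose_mul_self {N : ℕ} {M : Matrix (Fin N) (Fin N) ℝ} (h : M.PosSemidef) :
    ∃ B : Matrix (Fin N) (Fin N) ℝ, M = B.transpose * B := by
  obtain ⟨B, hB⟩ := CStarAlgebra.nonneg_iff_eq_star_mul_self.1 (Matrix.nonneg_iff_posSemidef.2 h)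
  exact ⟨B, hB⟩

/-! ### Sums of squares in a block of variables -/

/-- `q` is a sum of squares of polynomials in the variables of `Δ`. -/
def IsSOSIn (Δ : Finset (Fin n)) (q : MvPolynomial (Fin n) ℝ) : Prop :=
  ∃ (r : ℕ) (p : Fin r → MvPolynomial (Fin n) ℝ),
    (∀ j, p j ∈ supported ℝ (Δ : Set (Fin n))) ∧ q = ∑ j, p j ^ 2

theorem IsSOSIn.of_fintype {Δ : Finset (Fin n)} {ι : Type*} [Fintype ι]
    (p : ι → MvPolynomial (Fin n) ℝ) (hp : ∀ j, p j ∈ supported ℝ (Δ : Set (Fin n))) :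
    IsSOSIn Δ (∑ j, p j ^ 2) :=
  ⟨Fintype.card ι, fun j => p ((Fintype.equivFin ι).symm j), fun _ => hp _,
    (Equiv.sum_comp (Fintype.equivFin ι).symm fun j => p j ^ 2).symm⟩

theorem IsSOSIn.sum {Δ : Finset (Fin n)} {ι : Type*} [Fintype ι]
    {q : ι → MvPolynomial (Fin n) ℝ} (hq : ∀ j, IsSOSIn Δ (q j)) : IsSOSIn Δ (∑ j, q j) := by
  choose r p hp hqp using hq
  have := IsSOSIn.of_fintype (Δ := Δ) (fun x : Σ j, Fin (r j) => p x.1 x.2) fun x => hp x.1 x.2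
  rw [Fintype.sum_sigma] at this
  simpa only [hqp] using this

theorem IsSOSIn.add {Δ : Finset (Fin n)} {q₁ q₂ : MvPolynomial (Fin n) ℝ}
    (h₁ : IsSOSIn Δ q₁) (h₂ : IsSOSIn Δ q₂) : IsSOSIn Δ (q₁ + q₂) := by
  have := IsSOSIn.sum (Δ := Δ) (q := ![q₁, q₂]) (by
    intro j
    fin_cases j
    exacts [h₁, h₂])
  simpa using this

theorem IsSOSIn.eval_nonneg {Δ : Finset (Fin n)} {q : MvPolynomial (Fin n) ℝ}
    (h : IsSOSIn Δ q) (x : Fin n → ℝ) : 0 ≤ eval x q := by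
  obtain ⟨r, p, -, rfl⟩ := h
  simp only [map_sum, map_pow]
  exact Finset.sum_nonneg fun j _ => sq_nonneg _

/-- The algebra homomorphism setting the variables outside of `Δ` to zero. -/
def restrictVars (Δ : Finset (Fin n)) : MvPolynomial (Fin n) ℝ →ₐ[ℝ] MvPolynomial (Fin n) ℝ :=
  aeval fun i => if i ∈ Δ then X i else 0

theorem restrictVars_mem (Δ : Finset (Fin n)) (p : MvPolynomial (Fin n) ℝ) :
    restrictVars Δ p ∈ supported ℝ (Δ : Set (Fin n)) := by
  induction p using MvPolynomial.induction_on with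
  | C a =>
    rw [← algebraMap_eq, AlgHom.commutes]
    exact Subalgebra.algebraMap_mem _ a
  | add p q hp hq => rw [map_add]; exact add_mem hp hq
  | mul_X p i hp =>
    rw [map_mul]
    refine mul_mem hp ?_
    rw [restrictVars, aeval_X]
    split_ifs with h
    · exact X_mem_supported.2 h
    · exact zero_mem _

theorem restrictVars_eq_self {Δ : Finset (Fin n)} {p : MvPolynomial (Fin n) ℝ}
    (hp : p ∈ supported ℝ (Δ : Set (Fin n))) : restrictVars Δ p = p := by
  induction hp using Algebra.adjoin_induction with
  | mem x hx =>
    obtain ⟨i, hi, rfl⟩ := hx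
    rw [restrictVars, aeval_X, if_pos (by exact_mod_cast hi)]
  | algebraMap r => rw [AlgHom.commutes]
  | add p q _ _ hp hq => rw [map_add, hp, hq]
  | mul p q _ _ hp hq => rw [map_mul, hp, hq]

theorem pderiv_eq_zero_of_mem_supported {Δ : Finset (Fin n)} {p : MvPolynomial (Fin n) ℝ}
    (hp : p ∈ supported ℝ (Δ : Set (Fin n))) {s : Fin n} (hs : s ∉ Δ) : pderiv s p = 0 :=
  pderiv_eq_zero_of_notMem_vars fun h => hs (by exact_mod_cast mem_supported.1 hp h)

/-! ### First-order Taylor remainders -/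

/-- The remainder of the first order Taylor expansion at `u`. -/
def taylorRem (u : Fin n → ℝ) : MvPolynomial (Fin n) ℝ →ₗ[ℝ] MvPolynomial (Fin n) ℝ where
  toFun p := p - C (eval u p) - ∑ s, C (eval u (pderiv s p)) * (X s - C (u s))
  map_add' p q := by
    simp only [map_add, add_mul, Finset.sum_add_distrib]
    ring
  map_smul' c p := by
    simp only [smul_eq_C_mul, pderiv_C_mul, map_mul, eval_C, RingHom.id_apply, mul_assoc,
      ← Finset.mul_sum]
    ring

theorem taylorRem_apply (u : Fin n → ℝ) (p : MvPolynomial (Fin n) ℝ) :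
    taylorRem u p = p - C (eval u p) - ∑ s, C (eval u (pderiv s p)) * (X s - C (u s)) := rfl

theorem taylorRem_C (u : Fin n → ℝ) (c : ℝ) : taylorRem u (C c) = 0 := by
  simp [taylorRem_apply]

theorem taylorRem_mem {Δ : Finset (Fin n)} {p : MvPolynomial (Fin n) ℝ}
    (hp : p ∈ supported ℝ (Δ : Set (Fin n))) (u : Fin n → ℝ) :
    taylorRem u p ∈ supported ℝ (Δ : Set (Fin n)) := by
  have hC : ∀ c : ℝ, C c ∈ supported ℝ (Δ : Set (Fin n)) := fun c =>
    Subalgebra.algebraMap_mem _ c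
  refine sub_mem (sub_mem hp (hC _)) (sum_mem fun s _ => ?_)
  by_cases hs : s ∈ Δ
  · exact mul_mem (hC _) (sub_mem (X_mem_supported.2 hs) (hC _))
  · rw [pderiv_eq_zero_of_mem_supported hp hs, map_zero, map_zero, zero_mul]
    exact zero_mem _

theorem totalDegree_affine_le {ι : Type*} (t : Finset ι) (c : ℝ) (a b : ι → ℝ) (v : ι → Fin n) :
    (C c + ∑ s ∈ t, C (a s) * (X (v s) - C (b s)) : MvPolynomial (Fin n) ℝ).totalDegree ≤ 1 := by
  refine (totalDegree_add _ _).trans (max_le (by simp) ?_)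
  refine totalDegree_finsetSum_le fun s _ => ?_
  refine (totalDegree_mul _ _).trans ?_
  rw [totalDegree_C, zero_add]
  exact (totalDegree_sub _ _).trans (by simp)

theorem taylorRem_eq_sub (u : Fin n → ℝ) (p : MvPolynomial (Fin n) ℝ) :
    taylorRem u p =
      p - (C (eval u p) + ∑ s, C (eval u (pderiv s p)) * (X s - C (u s))) := by
  rw [taylorRem_apply, sub_sub]

theorem totalDegree_taylorRem_le (u : Fin n → ℝ) (p : MvPolynomial (Fin n) ℝ) :
    (taylorRem u p).totalDegree ≤ max p.totalDegree 1 := by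
  rw [taylorRem_eq_sub]
  exact (totalDegree_sub _ _).trans (max_le_max le_rfl (totalDegree_affine_le ..))

/-- The two polynomials differ by an affine one. This carries degree bounds back from the remainder,
where squares prevent cancellation, to `p`. -/
theorem totalDegree_le_taylorRem (u : Fin n → ℝ) (p : MvPolynomial (Fin n) ℝ) :
    p.totalDegree ≤ max (taylorRem u p).totalDegree 1 := by
  conv_lhs => rw [← sub_add_cancel p (C (eval u p) +
    ∑ s, C (eval u (pderiv s p)) * (X s - C (u s))), ← taylorRem_eq_sub]
  exact (totalDegree_add _ _).trans (max_le_max le_rfl (totalDegree_affine_le ..))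

/-! ### Taylor's formula with integral remainder, done algebraically -/

section Integral

variable {A : Type*} [CommRing A] [Algebra ℝ A]

/-- Integration of a polynomial in `t` against `(1 - t) dt` on the unit interval. -/
def weightedIntegral : Polynomial A →ₗ[ℝ] A :=
  Polynomial.lsum fun k => (1 / ((k + 1) * (k + 2)) : ℝ) • LinearMap.id

theorem weightedIntegral_monomial (k : ℕ) (a : A) :
    weightedIntegral (Polynomial.monomial k a) = (1 / ((k + 1) * (k + 2)) : ℝ) • a := by
  simp [weightedIntegral, Polynomial.lsum_apply, Polynomial.sum_monomial_index]

/-- Both sides are additive, so monomials suffice. Both vanish in degrees 0 and 1; in degree `m + 2`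
the factor `(m + 2)(m + 1)` from differentiating cancels the weight. -/
theorem eval_one_sub_eq_weightedIntegral (φ : Polynomial A) :
    φ.eval 1 - φ.eval 0 - (Polynomial.derivative φ).eval 0 =
      weightedIntegral (Polynomial.derivative (Polynomial.derivative φ)) := by
  induction φ using Polynomial.induction_on' with
  | add p q hp hq =>
    simp only [Polynomial.eval_add, map_add, ← hp, ← hq]
    ring
  | monomial m a =>
    rcases m with _ | _ | m
    · simp
    · simp
    · simp only [Polynomial.derivative_monomial, weightedIntegral_monomial,
        Polynomial.eval_monomial]
      have h : a * (((m + 1 + 1 : ℕ) : A)) * ((m + 1 + 1 - 1 : ℕ) : A) =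
          ((m + 2) * (m + 1) : ℝ) • a := by
        have h' : ((m + 2) * (m + 1) : ℝ) = ((m + 2) * (m + 1) : ℕ) := by push_cast; ring
        rw [h', Nat.cast_smul_eq_nsmul, nsmul_eq_mul]
        push_cast [Nat.add_sub_cancel]
        ring
      rw [h, smul_smul]
      have h1 : (m + 1 : ℝ) ≠ 0 := by positivity
      have h2 : (m + 2 : ℝ) ≠ 0 := by positivity
      have : (1 / (((m + 1 + 1 - 1 - 1 : ℕ) + 1) * ((m + 1 + 1 - 1 - 1 : ℕ) + 2)) *
          ((m + 2) * (m + 1)) : ℝ) = 1 := by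
        simp only [Nat.add_sub_cancel]
        field_simp
      rw [this]
      simp

/-- For `w = ∑ w_k t^k` the integral is `∑ M_kl w_k w_l`, where `M` is the real moment matrix. A
factorization `M = BᵀB` turns this into `∑_j (∑_k B_jk w_k)²`, in any real algebra `A`. -/
theorem weightedIntegral_sq (w : Polynomial A) :
    ∃ (r : ℕ) (q : Fin r → A), weightedIntegral (w ^ 2) = ∑ j, q j ^ 2 := by
  obtain ⟨B, hB⟩ := exists_transpose_mul_self (posSemidef_intervalMoment (w.natDegree + 1))
  refine ⟨w.natDegree + 1, fun j => ∑ k, B j k • w.coeff k, ?_⟩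
  have hw : w = ∑ k : Fin (w.natDegree + 1), Polynomial.monomial (k : ℕ) (w.coeff k) := by
    conv_lhs => rw [w.as_sum_range]
    exact (Fin.sum_univ_eq_sum_range (fun k => Polynomial.monomial k (w.coeff k)) _).symm
  have hBkl : ∀ k l : Fin (w.natDegree + 1),
      (1 / (((k + l : ℕ) + 1) * ((k + l : ℕ) + 2)) : ℝ) = ∑ j, B j k * B j l := by
    intro k l
    have := congrFun (congrFun hB k) l
    rw [Matrix.mul_apply] at this
    simpa using this
  conv_lhs => rw [hw, sq, Finset.sum_mul_sum]
  simp only [map_sum, Polynomial.monomial_mul_monomial, weightedIntegral_monomial, hBkl]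
  simp only [sq, Finset.sum_mul_sum, Finset.sum_smul]
  calc _ = ∑ k, ∑ j, ∑ l, (B j k * B j l) • (w.coeff k * w.coeff l) :=
        Finset.sum_congr rfl fun k _ => Finset.sum_comm
    _ = ∑ j, ∑ k, ∑ l, (B j k * B j l) • (w.coeff k * w.coeff l) := Finset.sum_comm
    _ = _ := by simp only [smul_mul_smul_comm]

end Integral

/-! ### SOS-convexity, tangents and minimizers -/

theorem exists_taylorRem_eq_sum_sq {p : MvPolynomial (Fin n) ℝ} (hp : IsSOSConvex p)
    (u : Fin n → ℝ) :
    ∃ (r : ℕ) (q : Fin r → MvPolynomial (Fin n) ℝ), taylorRem u p = ∑ j, q j ^ 2 := by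
  obtain ⟨r, Q, hQ⟩ := hp
  have hQst : ∀ s t, pderiv s (pderiv t p) = ∑ j, Q j s * Q j t := by
    intro s t
    have := congrFun (congrFun hQ s) t
    simpa [polyHessian, Matrix.mul_apply] using this
  -- The segment `u + t(x - u)` to the generic point `x`: a polynomial in `t` with coefficients in
  -- `ℝ[x]`.
  set w : Fin n → Polynomial (MvPolynomial (Fin n) ℝ) := fun s =>
    Polynomial.C (C (u s)) + Polynomial.X * Polynomial.C (X s - C (u s)) with hw
  have hdw : ∀ s, Polynomial.derivative (w s) = Polynomial.C (X s - C (u s)) := by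
    intro s
    simp [hw]
  have heval : ∀ (a : MvPolynomial (Fin n) ℝ) (g : MvPolynomial (Fin n) ℝ),
      (aeval w g).eval a = aeval (fun s => (w s).eval a) g := by
    intro a g
    exact comp_aeval_apply (σ := Fin n) w
      ((Polynomial.aeval a).restrictScalars ℝ :
        Polynomial (MvPolynomial (Fin n) ℝ) →ₐ[ℝ] MvPolynomial (Fin n) ℝ) g
  have heval1 : ∀ g, (aeval w g).eval 1 = g := by
    intro g
    rw [heval]
    simp [hw]
  have heval0 : ∀ g, (aeval w g).eval 0 = C (eval u g) := by
    intro g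
    rw [heval]
    simp only [hw, Polynomial.eval_add, Polynomial.eval_C, Polynomial.eval_mul, Polynomial.eval_X,
      zero_mul, add_zero]
    induction g using MvPolynomial.induction_on with
    | C a => simp
    | add p q hp hq => rw [map_add, hp, hq, map_add, map_add]
    | mul_X p i hp => rw [map_mul, hp, aeval_X, map_mul, map_mul, eval_X]
  have hd2 : Polynomial.derivative (Polynomial.derivative (aeval w p)) =
      ∑ j, (∑ s, aeval w (Q j s) * Polynomial.C (X s - C (u s))) ^ 2 := by
    have h1 : Polynomial.derivative (Polynomial.derivative (aeval w p)) =
        ∑ t, ∑ s, ∑ j, (aeval w (Q j s) * Polynomial.C (X s - C (u s))) *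
          (aeval w (Q j t) * Polynomial.C (X t - C (u t))) := by
      rw [derivative_aeval, Polynomial.derivative_sum]
      refine Finset.sum_congr rfl fun t _ => ?_
      rw [hdw, Polynomial.derivative_mul, Polynomial.derivative_C, mul_zero, add_zero,
        derivative_aeval, Finset.sum_mul]
      refine Finset.sum_congr rfl fun s _ => ?_
      rw [hdw, hQst, map_sum, Finset.sum_mul, Finset.sum_mul]
      refine Finset.sum_congr rfl fun j _ => ?_
      rw [map_mul]
      ring
    rw [h1, Finset.sum_comm]
    simp only [sq, Finset.sum_mul_sum]
    calc _ = ∑ s, ∑ j, ∑ t, (aeval w (Q j s) * Polynomial.C (X s - C (u s))) *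
          (aeval w (Q j t) * Polynomial.C (X t - C (u t))) :=
          Finset.sum_congr rfl fun s _ => Finset.sum_comm
      _ = _ := Finset.sum_comm
  have key := eval_one_sub_eq_weightedIntegral (aeval w p)
  rw [heval1, heval0, hd2, map_sum, derivative_aeval] at key
  choose N q hq using fun j => weightedIntegral_sq
    (∑ s, aeval w (Q j s) * Polynomial.C (X s - C (u s)))
  have hL : taylorRem u p = ∑ x : (Σ j, Fin (N j)), q x.1 x.2 ^ 2 := by
    rw [Fintype.sum_sigma, ← Finset.sum_congr rfl fun j _ => hq j, ← key, taylorRem_apply]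
    simp [Polynomial.eval_finsetSum, hdw, heval0]
  refine ⟨_, fun j => q ((Fintype.equivFin (Σ j, Fin (N j))).symm j).1 ((Fintype.equivFin _).symm j).2, ?_⟩
  rw [hL]
  exact (Equiv.sum_comp (Fintype.equivFin _).symm
    fun x : (Σ j, Fin (N j)) => q x.1 x.2 ^ 2).symm

/-- An SOS-convex polynomial differs from its tangent at any point by a sum of squares. -/
theorem isSOSIn_taylorRem {Δ : Finset (Fin n)} {p : MvPolynomial (Fin n) ℝ}
    (hΔ : p ∈ supported ℝ (Δ : Set (Fin n))) (hp : IsSOSConvex p) (u : Fin n → ℝ) :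
    IsSOSIn Δ (taylorRem u p) := by
  obtain ⟨r, q, hq⟩ := exists_taylorRem_eq_sum_sq hp u
  -- Setting the variables outside `Δ` to zero fixes the remainder and maps squares to squares.
  refine ⟨r, fun j => restrictVars Δ (q j), fun j => restrictVars_mem _ _, ?_⟩
  rw [← restrictVars_eq_self (taylorRem_mem hΔ u), hq]
  simp only [map_sum, map_pow]

theorem eval_taylorRem (u x : Fin n → ℝ) (p : MvPolynomial (Fin n) ℝ) :
    eval x (taylorRem u p) =
      eval x p - eval u p - ∑ s, eval u (pderiv s p) * (x s - u s) := by
  simp [taylorRem_apply]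

/-- SOS-convex polynomials are convex functions. -/
theorem convexOn_eval_of_isSOSConvex {p : MvPolynomial (Fin n) ℝ} (hp : IsSOSConvex p) :
    ConvexOn ℝ Set.univ fun x => eval x p := by
  refine ⟨convex_univ, fun x _ y _ a b ha hb hab => ?_⟩
  have hu : p ∈ supported ℝ ((Finset.univ : Finset (Fin n)) : Set (Fin n)) := by
    rw [Finset.coe_univ, supported_univ]
    trivial
  have hx := (isSOSIn_taylorRem hu hp (a • x + b • y)).eval_nonneg x
  have hy := (isSOSIn_taylorRem hu hp (a • x + b • y)).eval_nonneg y
  rw [eval_taylorRem] at hx hy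
  set u := a • x + b • y with hu_def
  -- The tangent is taken at `ax + by`, so its linear terms at `x` and `y` cancel with weights `a`
  -- and `b`.
  have hlin : a * ∑ s, eval u (pderiv s p) * (x s - u s) +
      b * ∑ s, eval u (pderiv s p) * (y s - u s) = 0 := by
    rw [Finset.mul_sum, Finset.mul_sum, ← Finset.sum_add_distrib]
    refine Finset.sum_eq_zero fun s _ => ?_
    have : u s = a * x s + b * y s := by simp [hu_def]
    obtain rfl : b = 1 - a := by linarith
    rw [this]
    ring
  have h1 := mul_nonneg ha hx
  have h2 := mul_nonneg hb hy
  simp only [smul_eq_mul]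
  have h3 : eval u p = a * eval u p + b * eval u p := by rw [← add_mul, hab, one_mul]
  nlinarith

/-- The gradient of a polynomial vanishes at a global minimizer. -/
theorem eval_pderiv_eq_zero_of_isMin {p : MvPolynomial (Fin n) ℝ} {u : Fin n → ℝ}
    (h : ∀ x, eval u p ≤ eval x p) (s : Fin n) : eval u (pderiv s p) = 0 := by
  -- The line through `u` in the `s`th coordinate direction reduces the claim to one variable.
  set w : Fin n → Polynomial ℝ := fun i => Polynomial.C (u i) + if i = s then Polynomial.X else 0
    with hw
  have heval : ∀ (a : ℝ) g, (aeval w g).eval a = eval (fun i => (w i).eval a) g := by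
    intro a g
    exact comp_aeval_apply (σ := Fin n) w (Polynomial.aeval a : Polynomial ℝ →ₐ[ℝ] ℝ) g
  have hw0 : (fun i => (w i).eval 0) = u := by
    funext i
    simp only [hw, Polynomial.eval_add, Polynomial.eval_C]
    split_ifs <;> simp
  have hmin : IsLocalMin (fun a => (aeval w p).eval a) 0 := by
    refine Filter.Eventually.of_forall fun a => ?_
    simp only [heval, hw0]
    exact h _
  have hd := hmin.deriv_eq_zero
  rw [Polynomial.deriv, derivative_aeval, Polynomial.eval_finsetSum,
    Finset.sum_eq_single s] at hd
  · have hds : Polynomial.derivative (w s) = 1 := by simp [hw]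
    rwa [hds, mul_one, heval, hw0] at hd
  · intro i _ hi
    simp [hw, hi]
  · simp

/-! ### Quadratic forms of matrix polynomials -/

theorem eval_quadForm {l : ℕ} (G : Matrix (Fin l) (Fin l) (MvPolynomial (Fin n) ℝ))
    (ξ : Fin l → ℝ) (x : Fin n → ℝ) :
    eval x (quadForm G ξ) = ∑ a, ∑ b, eval x (G a b) * (ξ a * ξ b) := by
  simp [quadForm, mul_comm]

theorem quadForm_neg {l : ℕ} (G : Matrix (Fin l) (Fin l) (MvPolynomial (Fin n) ℝ))
    (ξ : Fin l → ℝ) : quadForm (-G) ξ = -quadForm G ξ := by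
  simp [quadForm]

theorem quadForm_mem {Δ : Finset (Fin n)} {l : ℕ}
    {G : Matrix (Fin l) (Fin l) (MvPolynomial (Fin n) ℝ)}
    (hG : ∀ a b, G a b ∈ supported ℝ (Δ : Set (Fin n))) (ξ : Fin l → ℝ) :
    quadForm G ξ ∈ supported ℝ (Δ : Set (Fin n)) :=
  sum_mem fun a _ => sum_mem fun b _ => mul_mem (Subalgebra.algebraMap_mem _ _) (hG a b)

theorem totalDegree_le_matDeg {l : ℕ} (G : Matrix (Fin l) (Fin l) (MvPolynomial (Fin n) ℝ))
    (a b : Fin l) : (G a b).totalDegree ≤ matDeg G :=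
  (Finset.le_sup (f := fun b => (G a b).totalDegree) (Finset.mem_univ b)).trans
    (Finset.le_sup (f := fun a => Finset.univ.sup fun b => (G a b).totalDegree)
      (Finset.mem_univ a))

theorem totalDegree_quadForm_le {l : ℕ} (G : Matrix (Fin l) (Fin l) (MvPolynomial (Fin n) ℝ))
    (ξ : Fin l → ℝ) : (quadForm G ξ).totalDegree ≤ matDeg G := by
  refine totalDegree_finsetSum_le fun a _ => totalDegree_finsetSum_le fun b _ => ?_
  refine (totalDegree_mul _ _).trans ?_
  rw [totalDegree_C, zero_add]
  exact totalDegree_le_matDeg G a b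

theorem dotProduct_mulVec_eq_sum {l : ℕ} (M : Matrix (Fin l) (Fin l) ℝ) (ξ : Fin l → ℝ) :
    star ξ ⬝ᵥ M.mulVec ξ = ∑ a, ∑ b, M a b * (ξ a * ξ b) := by
  simp only [dotProduct, Matrix.mulVec, star_trivial, Finset.mul_sum]
  exact Finset.sum_congr rfl fun a _ => Finset.sum_congr rfl fun b _ => by ring

theorem eval_quadForm_eq_dotProduct {l : ℕ} (G : Matrix (Fin l) (Fin l) (MvPolynomial (Fin n) ℝ))
    (ξ : Fin l → ℝ) (x : Fin n → ℝ) :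
    eval x (quadForm G ξ) = star ξ ⬝ᵥ (G.map (eval x)).mulVec ξ := by
  rw [dotProduct_mulVec_eq_sum, eval_quadForm]
  rfl

/-- Replaces the matrix constraint by the scalar constraints `ξᵀGξ ≥ 0`, the form in which
SOS-concavity is given. -/
theorem posSemidef_map_eval_iff {l : ℕ} {G : Matrix (Fin l) (Fin l) (MvPolynomial (Fin n) ℝ)}
    (hG : G.IsSymm) (x : Fin n → ℝ) :
    (G.map (eval x)).PosSemidef ↔ ∀ ξ, 0 ≤ eval x (quadForm G ξ) := by
  have hH : (G.map (eval x)).IsHermitian := by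
    ext a b
    simp [hG.apply a b]
  rw [Matrix.posSemidef_iff_dotProduct_mulVec]
  simp only [eval_quadForm_eq_dotProduct, hH, true_and]

/-! ### Lagrange multipliers for matrix constraints -/

section Multipliers

variable {m : ℕ} {ℓ : Fin m → ℕ}

/-- Families of square matrices, as vectors of entries. -/
abbrev MatFamily (ℓ : Fin m → ℕ) : Type := (Σ i, Fin (ℓ i) × Fin (ℓ i)) → ℝ

/-- The quadratic form of the `i`th member of a family of matrices. -/
def MatFamily.form (i : Fin m) (ξ : Fin (ℓ i) → ℝ) (M : MatFamily ℓ) : ℝ :=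
  ∑ a, ∑ b, M ⟨i, a, b⟩ * (ξ a * ξ b)

theorem MatFamily.form_sub (i : Fin m) (ξ : Fin (ℓ i) → ℝ) (M N : MatFamily ℓ) :
    MatFamily.form i ξ (M - N) = MatFamily.form i ξ M - MatFamily.form i ξ N := by
  simp [MatFamily.form, sub_mul, Finset.sum_sub_distrib]

theorem MatFamily.form_add (i : Fin m) (ξ : Fin (ℓ i) → ℝ) (M N : MatFamily ℓ) :
    MatFamily.form i ξ (M + N) = MatFamily.form i ξ M + MatFamily.form i ξ N := by
  simp [MatFamily.form, add_mul, Finset.sum_add_distrib]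

theorem MatFamily.form_smul (i : Fin m) (ξ : Fin (ℓ i) → ℝ) (c : ℝ) (M : MatFamily ℓ) :
    MatFamily.form i ξ (c • M) = c * MatFamily.form i ξ M := by
  simp [MatFamily.form, Finset.mul_sum, mul_assoc]

theorem MatFamily.form_smul_vec (i : Fin m) (ξ : Fin (ℓ i) → ℝ) (c : ℝ) (M : MatFamily ℓ) :
    MatFamily.form i (c • ξ) M = c ^ 2 * MatFamily.form i ξ M := by
  simp only [MatFamily.form, Finset.mul_sum, Pi.smul_apply, smul_eq_mul]
  exact Finset.sum_congr rfl fun a _ => Finset.sum_congr rfl fun b _ => by ring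

/-- The families of matrices all of whose quadratic forms are positive definite. -/
def MatFamily.posDef (ℓ : Fin m → ℕ) : Set (MatFamily ℓ) :=
  {M | ∀ i, ∀ ξ : Fin (ℓ i) → ℝ, ξ ≠ 0 → 0 < MatFamily.form i ξ M}

/-- By homogeneity it is enough to test on unit spheres. These are compact, so strict positivity
survives small perturbations. -/
theorem MatFamily.isOpen_posDef : IsOpen (MatFamily.posDef ℓ) := by
  have h : MatFamily.posDef ℓ = ⋂ i, {M : MatFamily ℓ |
      ∀ ξ ∈ Metric.sphere (0 : Fin (ℓ i) → ℝ) 1, 0 < MatFamily.form i ξ M} := by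
    ext M
    simp only [MatFamily.posDef, Set.mem_ofPred_eq, Set.mem_iInter, mem_sphere_zero_iff_norm]
    refine forall_congr' fun i => ⟨fun h ξ hξ => h ξ (by rintro rfl; simp at hξ), fun h ξ hξ => ?_⟩
    have hn : 0 < ‖ξ‖ := norm_pos_iff.2 hξ
    have h1 := h (‖ξ‖⁻¹ • ξ) (by rw [norm_smul, norm_inv, norm_norm, inv_mul_cancel₀ hn.ne'])
    rw [MatFamily.form_smul_vec] at h1
    exact (pos_iff_pos_of_mul_pos h1).1 (by positivity)
  rw [h]
  refine isOpen_iInter_of_finite fun i => ?_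
  have hK : IsCompact (Metric.sphere (0 : Fin (ℓ i) → ℝ) 1) := isCompact_sphere 0 1
  refine isOpen_iff_mem_nhds.2 fun M hM => ?_
  refine hK.eventually_forall_of_forall_eventually (x₀ := M) fun ξ hξ => ?_
  have hcont : Continuous fun z : MatFamily ℓ × (Fin (ℓ i) → ℝ) => MatFamily.form i z.2 z.1 := by
    unfold MatFamily.form
    fun_prop
  exact hcont.continuousAt.eventually (lt_mem_nhds (hM ξ hξ))

/-- A family of symmetric matrices with positive semidefinite members splits, as a functional on
families of symmetric matrices, into evaluations of quadratic forms. -/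
theorem MatFamily.exists_sum_form (Λ : MatFamily ℓ)
    (hΛ : ∀ i, ∀ ξ : Fin (ℓ i) → ℝ, 0 ≤ MatFamily.form i ξ Λ) :
    ∃ B : ∀ i, Fin (ℓ i) → Fin (ℓ i) → ℝ, ∀ M : MatFamily ℓ,
      (∀ i a b, M ⟨i, a, b⟩ = M ⟨i, b, a⟩) →
      ∑ e, M e * Λ e = ∑ i, ∑ j, MatFamily.form i (B i j) M := by
  -- Symmetric `M` only see the symmetric part of `Λ`; the rows of its factor `B` give the quadratic
  -- forms.
  have hS : ∀ i, (Matrix.of fun a b => (Λ ⟨i, a, b⟩ + Λ ⟨i, b, a⟩) / 2 :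
      Matrix (Fin (ℓ i)) (Fin (ℓ i)) ℝ).PosSemidef := by
    intro i
    refine Matrix.PosSemidef.of_dotProduct_mulVec_nonneg ?_ fun ξ => ?_
    · ext a b
      simp [add_comm]
    · rw [dotProduct_mulVec_eq_sum]
      refine (hΛ i ξ).trans_eq ?_
      have hswap : MatFamily.form i ξ Λ = ∑ a, ∑ b, Λ ⟨i, b, a⟩ * (ξ a * ξ b) := by
        rw [MatFamily.form, Finset.sum_comm]
        exact Finset.sum_congr rfl fun a _ => Finset.sum_congr rfl fun b _ => by ring
      have : MatFamily.form i ξ Λ = (MatFamily.form i ξ Λ + MatFamily.form i ξ Λ) / 2 := by ring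
      rw [this]
      nth_rewrite 2 [hswap]
      rw [MatFamily.form, ← Finset.sum_add_distrib, Finset.sum_div]
      refine Finset.sum_congr rfl fun a _ => ?_
      rw [← Finset.sum_add_distrib, Finset.sum_div]
      refine Finset.sum_congr rfl fun b _ => ?_
      simp only [Matrix.of_apply]
      ring
  choose B hB using fun i => exists_transpose_mul_self (hS i)
  refine ⟨B, fun M hM => ?_⟩
  rw [Fintype.sum_sigma]
  refine Finset.sum_congr rfl fun i _ => ?_
  rw [Fintype.sum_prod_type]
  have hswap : ∑ a, ∑ b, M ⟨i, a, b⟩ * Λ ⟨i, a, b⟩ = ∑ a, ∑ b, M ⟨i, a, b⟩ * Λ ⟨i, b, a⟩ := by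
    rw [Finset.sum_comm]
    exact Finset.sum_congr rfl fun a _ => Finset.sum_congr rfl fun b _ => by rw [hM]
  have h2 : ∑ a, ∑ b, M ⟨i, a, b⟩ * Λ ⟨i, a, b⟩ =
      ∑ a, ∑ b, M ⟨i, a, b⟩ * ((Λ ⟨i, a, b⟩ + Λ ⟨i, b, a⟩) / 2) := by
    have h3 : ∑ a, ∑ b, M ⟨i, a, b⟩ * ((Λ ⟨i, a, b⟩ + Λ ⟨i, b, a⟩) / 2) =
        (∑ a, ∑ b, M ⟨i, a, b⟩ * Λ ⟨i, a, b⟩ + ∑ a, ∑ b, M ⟨i, a, b⟩ * Λ ⟨i, b, a⟩) / 2 := by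
      rw [← Finset.sum_add_distrib, Finset.sum_div]
      refine Finset.sum_congr rfl fun a _ => ?_
      rw [← Finset.sum_add_distrib, Finset.sum_div]
      exact Finset.sum_congr rfl fun b _ => by ring
    rw [h3, ← hswap]
    ring
  rw [h2]
  have hent : ∀ a b, (Λ ⟨i, a, b⟩ + Λ ⟨i, b, a⟩) / 2 = ∑ j, B i j a * B i j b := by
    intro a b
    have := congrFun (congrFun (hB i) a) b
    rwa [Matrix.mul_apply] at this
  simp only [hent, MatFamily.form, Finset.mul_sum]
  rw [Finset.sum_comm' (t' := Finset.univ) (s' := fun _ => Finset.univ) (by simp)]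
  calc _ = ∑ b, ∑ j, ∑ a, M ⟨i, a, b⟩ * (B i j a * B i j b) :=
        Finset.sum_congr rfl fun b _ => Finset.sum_comm
    _ = ∑ j, ∑ b, ∑ a, M ⟨i, a, b⟩ * (B i j a * B i j b) := Finset.sum_comm
    _ = _ := Finset.sum_congr rfl fun j _ => Finset.sum_comm

/-- Lagrange multipliers for a convex program with concave matrix constraints, symmetric as matrices,
under Slater's condition. -/
theorem exists_lagrange_multipliers {E : Type*} [AddCommGroup E] [Module ℝ E]
    {F : E → ℝ} {H : E → MatFamily ℓ} (hF : ConvexOn ℝ Set.univ F)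
    (hH : ∀ i, ∀ ξ : Fin (ℓ i) → ℝ, ConcaveOn ℝ Set.univ fun x => MatFamily.form i ξ (H x))
    (hsymm : ∀ x i a b, H x ⟨i, a, b⟩ = H x ⟨i, b, a⟩)
    (hslater : ∃ x, H x ∈ MatFamily.posDef ℓ)
    (hnonneg : ∀ x, (∀ i, ∀ ξ : Fin (ℓ i) → ℝ, 0 ≤ MatFamily.form i ξ (H x)) → 0 ≤ F x) :
    ∃ B : ∀ i, Fin (ℓ i) → Fin (ℓ i) → ℝ, ∀ x,
      ∑ i, ∑ j, MatFamily.form i (B i j) (H x) ≤ F x := by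
  -- The pairs `(r, M)` strictly beaten by some `x`: smaller objective and larger constraint value.
  -- Nonnegativity of `F` on the feasible set keeps the origin out, so a functional that is negative
  -- on `S` exists.
  set S : Set (ℝ × MatFamily ℓ) := {z | ∃ x, F x < z.1 ∧ H x - z.2 ∈ MatFamily.posDef ℓ} with hS
  have hconv : Convex ℝ S := by
    rintro ⟨r, M⟩ ⟨x, hx1, hx2⟩ ⟨s, N⟩ ⟨y, hy1, hy2⟩ a b ha hb hab
    refine ⟨a • x + b • y, ?_, fun i ξ hξ => ?_⟩
    · have h1 := hF.2 (Set.mem_univ x) (Set.mem_univ y) ha hb hab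
      refine h1.trans_lt ?_
      simp only [smul_eq_mul, Prod.fst_add, Prod.smul_fst] at hx1 hy1 ⊢
      rcases ha.eq_or_lt with rfl | ha'
      · obtain rfl : b = 1 := by linarith
        linarith
      · have := mul_lt_mul_of_pos_left hx1 ha'
        have := mul_le_mul_of_nonneg_left hy1.le hb
        linarith
    · have h1 := (hH i ξ).2 (Set.mem_univ x) (Set.mem_univ y) ha hb hab
      have h2 := hx2 i ξ hξ
      have h3 := hy2 i ξ hξ
      simp only [smul_eq_mul, MatFamily.form_sub, MatFamily.form_add, MatFamily.form_smul,
        Prod.snd_add, Prod.smul_snd] at h1 h2 h3 ⊢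
      rcases ha.eq_or_lt with rfl | ha'
      · obtain rfl : b = 1 := by linarith
        linarith
      · have := mul_pos ha' h2
        have := mul_nonneg hb h3.le
        linarith
  have hopen : IsOpen S := by
    have : S = ⋃ x, {z : ℝ × MatFamily ℓ | F x < z.1} ∩
        (fun z => H x - z.2) ⁻¹' MatFamily.posDef ℓ := by
      ext z
      simp [hS]
    rw [this]
    exact isOpen_iUnion fun x => (isOpen_lt continuous_const continuous_fst).inter
      (MatFamily.isOpen_posDef.preimage (by fun_prop))
  have h0 : (0 : ℝ × MatFamily ℓ) ∉ S := by
    rintro ⟨x, hx1, hx2⟩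
    refine not_lt.2 (hnonneg x fun i ξ => ?_) hx1
    rcases eq_or_ne ξ 0 with rfl | hξ
    · simp [MatFamily.form]
    · simpa using (hx2 i ξ hξ).le
  obtain ⟨φ, hφ⟩ := geometric_hahn_banach_open_point hconv hopen h0
  rw [map_zero] at hφ
  set c : ℝ := -φ (1, 0) with hc
  set Λ : MatFamily ℓ := fun e => φ (0, Pi.single e 1) with hΛ
  have hrep : ∀ r M, φ (r, M) = -(c * r) + ∑ e, M e * Λ e := by
    intro r M
    have h1 : (r, M) = r • ((1, 0) : ℝ × MatFamily ℓ) + ∑ e, M e • ((0, Pi.single e 1)) := by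
      refine Prod.ext ?_ ?_
      · simp [Prod.fst_sum]
      · simp only [Prod.snd_add, Prod.smul_snd, smul_zero, Prod.snd_sum, zero_add]
        exact pi_eq_sum_univ' M
    rw [h1, map_add, map_smul, map_sum]
    simp only [map_smul, smul_eq_mul, hc, hΛ]
    ring
  obtain ⟨x₀, hx₀⟩ := hslater
  -- Slater's condition enters here: `S` contains a point with matrix part 0, so the objective has a
  -- nonzero weight.
  have hcpos : 0 < c := by
    have h1 := hφ (|F x₀| + 1, 0) ⟨x₀, by linarith [le_abs_self (F x₀)], by simpa using hx₀⟩
    rw [hrep] at h1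
    simp only [Pi.zero_apply, zero_mul, Finset.sum_const_zero, add_zero, Left.neg_neg_iff] at h1
    exact pos_of_mul_pos_left h1 (by positivity)
  have hform : ∀ i, ∀ ξ : Fin (ℓ i) → ℝ, 0 ≤ MatFamily.form i ξ Λ := by
    intro i ξ
    set N : MatFamily ℓ := fun e =>
      (Pi.single i ξ : ∀ i, Fin (ℓ i) → ℝ) e.1 e.2.1 * (Pi.single i ξ : ∀ i, Fin (ℓ i) → ℝ) e.1 e.2.2
      with hN
    have hNform : ∀ i', ∀ ζ : Fin (ℓ i') → ℝ, 0 ≤ MatFamily.form i' ζ N := by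
      intro i' ζ
      have : MatFamily.form i' ζ N =
          (∑ a, (Pi.single i ξ : ∀ i, Fin (ℓ i) → ℝ) i' a * ζ a) ^ 2 := by
        rw [sq, Finset.sum_mul_sum]
        exact Finset.sum_congr rfl fun a _ => Finset.sum_congr rfl fun b _ => by
          simp only [hN]
          ring
      rw [this]
      exact sq_nonneg _
    have hNΛ : ∑ e, N e * Λ e = MatFamily.form i ξ Λ := by
      rw [Fintype.sum_sigma, Finset.sum_eq_single i]
      · rw [Fintype.sum_prod_type]
        exact Finset.sum_congr rfl fun a _ => Finset.sum_congr rfl fun b _ => by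
          simp only [hN, Pi.single_eq_same]
          ring
      · intro i' _ hi'
        refine Finset.sum_eq_zero fun e _ => ?_
        simp [hN, Pi.single_eq_of_ne hi']
      · simp
    by_contra! hneg
    -- `N` is `ξξᵀ` in block `i`, and subtracting multiples of it stays in `S`. If the form of `Λ`
    -- at `ξ` were negative, this `t` would make the functional exactly 0 at a point of `S`.
    set t : ℝ := -(c * (|F x₀| + 1)) / MatFamily.form i ξ Λ with ht
    have ht0 : 0 ≤ t := div_nonneg_of_nonpos (by
      have : 0 < c * (|F x₀| + 1) := by positivity
      linarith) hneg.le
    have h1 := hφ (|F x₀| + 1, (-t) • N) ⟨x₀, by linarith [le_abs_self (F x₀)], fun i' ζ hζ => by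
      rw [MatFamily.form_sub, MatFamily.form_smul]
      have := hx₀ i' ζ hζ
      have := mul_nonneg ht0 (hNform i' ζ)
      linarith⟩
    rw [hrep] at h1
    simp only [Pi.smul_apply, smul_eq_mul, mul_assoc, ← Finset.mul_sum, hNΛ] at h1
    have h2 : t * MatFamily.form i ξ Λ = -(c * (|F x₀| + 1)) := div_mul_cancel₀ _ hneg.ne
    linarith
  obtain ⟨B, hB⟩ := MatFamily.exists_sum_form (c⁻¹ • Λ) fun i ξ => by
    rw [MatFamily.form_smul]
    exact mul_nonneg (inv_nonneg.2 hcpos.le) (hform i ξ)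
  refine ⟨B, fun x => ?_⟩
  rw [← hB (H x) (hsymm x)]
  -- The pair `(F x, H x)` is only a limit of points of `S`; shifting by `ε` and by `ε` times the
  -- identity moves it inside, and then `ε` tends to 0.
  set I : MatFamily ℓ := fun e => if e.2.1 = e.2.2 then 1 else 0 with hI
  have hIpos : I ∈ MatFamily.posDef ℓ := by
    intro i ξ hξ
    have h1 : MatFamily.form i ξ I = ∑ a, ξ a ^ 2 := by
      simp [MatFamily.form, hI, sq]
    rw [h1]
    obtain ⟨a, ha⟩ := Function.ne_iff.1 hξ
    exact Finset.sum_pos' (fun a _ => sq_nonneg _) ⟨a, Finset.mem_univ a, sq_pos_of_ne_zero ha⟩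
  have hlt : ∀ ε : ℝ, 0 < ε →
      ∑ e, H x e * Λ e < c * F x + ε * (c + ∑ e, I e * Λ e) := by
    intro ε hε
    have h1 := hφ (F x + ε, H x - ε • I) ⟨x, by simpa using hε, fun i ξ hξ => by
      rw [sub_sub_cancel, MatFamily.form_smul]
      exact mul_pos hε (hIpos i ξ hξ)⟩
    rw [hrep] at h1
    simp only [Pi.sub_apply, Pi.smul_apply, smul_eq_mul, sub_mul, Finset.sum_sub_distrib,
      mul_assoc, ← Finset.mul_sum] at h1
    linarith
  have hle : ∑ e, H x e * Λ e ≤ c * F x := by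
    by_contra! hcon
    set D := c + ∑ e, I e * Λ e
    have hε : 0 < (∑ e, H x e * Λ e - c * F x) / (|D| + 1) :=
      div_pos (by linarith) (by positivity)
    have h1 := hlt _ hε
    have h2 := mul_le_mul_of_nonneg_left (show D ≤ |D| + 1 by linarith [le_abs_self D]) hε.le
    rw [div_mul_cancel₀ _ (by positivity : |D| + 1 ≠ 0)] at h2
    linarith
  have h3 : ∑ e, H x e * (c⁻¹ • Λ) e = c⁻¹ * ∑ e, H x e * Λ e := by
    rw [Finset.mul_sum]
    exact Finset.sum_congr rfl fun e _ => by
      simp only [Pi.smul_apply, smul_eq_mul]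
      ring
  rw [h3, inv_mul_le_iff₀ hcpos]
  exact hle

end Multipliers

/-! ### Riesz functionals and Jensen's inequality -/

section Riesz

variable {Δ : Finset (Fin n)} {d : ℕ}

/-- The Riesz functional as a linear map. -/
def rieszLin (z : monPowers Δ d → ℝ) : MvPolynomial (Fin n) ℝ →ₗ[ℝ] ℝ where
  toFun := riesz z
  map_add' p q := by simp [riesz, add_mul, Finset.sum_add_distrib]
  map_smul' c p := by simp [riesz, Finset.mul_sum, mul_assoc]

theorem rieszLin_apply (z : monPowers Δ d → ℝ) (p : MvPolynomial (Fin n) ℝ) :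
    rieszLin z p = riesz z p := rfl

theorem riesz_monomial (z : monPowers Δ d → ℝ) (α : monPowers Δ d) (c : ℝ) :
    riesz z (monomial α.1 c) = c * z α := by
  rw [riesz, Finset.sum_eq_single α]
  · simp
  · intro β _ hβ
    rw [coeff_monomial, if_neg fun h => hβ (Subtype.ext h.symm), zero_mul]
  · simp

theorem mem_monPowers_of_mem_support {p : MvPolynomial (Fin n) ℝ}
    (hp : p ∈ supported ℝ (Δ : Set (Fin n))) (hd : p.totalDegree ≤ d) {α : Fin n →₀ ℕ}
    (hα : α ∈ p.support) : α ∈ monPowers Δ d := by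
  refine mem_monPowers.2 ⟨fun i hi => ?_, (le_totalDegree hα).trans hd⟩
  have := mem_supported.1 hp ((mem_vars_iff_mem_support _).2 ⟨α, hα, hi⟩)
  exact_mod_cast this

theorem eq_sum_monomial {p : MvPolynomial (Fin n) ℝ}
    (hp : p ∈ supported ℝ (Δ : Set (Fin n))) (hd : p.totalDegree ≤ d) :
    p = ∑ α : monPowers Δ d, monomial α.1 (coeff α.1 p) := by
  rw [Finset.sum_coe_sort (monPowers Δ d) fun α => monomial α (coeff α p)]
  conv_lhs => rw [p.as_sum]
  refine Finset.sum_subset (fun α hα => mem_monPowers_of_mem_support hp hd hα) fun α _ hα => ?_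
  rw [notMem_support_iff.1 hα, monomial_zero]

theorem riesz_sq_nonneg {k : ℕ} {z : monPowers Δ (2 * k) → ℝ}
    (hz : (momentMatrix k z).PosSemidef) {q : MvPolynomial (Fin n) ℝ}
    (hq : q ∈ supported ℝ (Δ : Set (Fin n))) (hd : q.totalDegree ≤ k) : 0 ≤ riesz z (q ^ 2) := by
  have h := hz.dotProduct_mulVec_nonneg fun α => coeff α.1 q
  refine h.trans_eq ?_
  rw [← rieszLin_apply]
  conv_rhs => rw [eq_sum_monomial hq hd, sq, Finset.sum_mul_sum]
  simp only [dotProduct, Matrix.mulVec, star_trivial, Finset.mul_sum, map_sum]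
  refine Finset.sum_congr rfl fun α _ => Finset.sum_congr rfl fun β _ => ?_
  have : monomial α.1 (coeff α.1 q) * monomial β.1 (coeff β.1 q) =
      (coeff α.1 q * coeff β.1 q) • (1 * (monomial α.1 (1 : ℝ) * monomial β.1 1)) := by
    simp [monomial_mul, smul_monomial]
  rw [this, map_smul, rieszLin_apply]
  simp only [momentMatrix, locBlock, Matrix.of_apply, smul_eq_mul]
  ring

/-- The moment matrix only controls squares of polynomials of degree at most `k`; absence of
cancellation shows that no others occur. -/
theorem riesz_nonneg_of_isSOSIn {k : ℕ} {z : monPowers Δ (2 * k) → ℝ}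
    (hz : (momentMatrix k z).PosSemidef) {q : MvPolynomial (Fin n) ℝ} (hq : IsSOSIn Δ q)
    (hd : q.totalDegree ≤ 2 * k) : 0 ≤ riesz z q := by
  obtain ⟨r, p, hp, rfl⟩ := hq
  have hdeg := totalDegree_le_of_sum_sq _ _ hd
  rw [← rieszLin_apply, map_sum]
  exact Finset.sum_nonneg fun j hj => riesz_sq_nonneg hz (hp j) (hdeg j hj)

theorem riesz_eval (x : Fin n → ℝ) {p : MvPolynomial (Fin n) ℝ}
    (hp : p ∈ supported ℝ (Δ : Set (Fin n))) (hd : p.totalDegree ≤ d) :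
    riesz (fun α : monPowers Δ d => eval x (monomial α.1 1)) p = eval x p := by
  conv_rhs => rw [eq_sum_monomial hp hd, map_sum]
  refine Finset.sum_congr rfl fun α _ => ?_
  simp [eval_monomial]

/-- Jensen's inequality for Riesz functionals and SOS-convex polynomials. -/
theorem eval_le_riesz {k : ℕ} (hk : 1 ≤ k) {z : monPowers Δ (2 * k) → ℝ}
    (hz : (momentMatrix k z).PosSemidef) {p : MvPolynomial (Fin n) ℝ}
    (hp : p ∈ supported ℝ (Δ : Set (Fin n))) (hd : p.totalDegree ≤ 2 * k) (hc : IsSOSConvex p)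
    {x : Fin n → ℝ} (h0 : riesz z 1 = 1) (hx : ∀ s ∈ Δ, riesz z (X s) = x s) :
    eval x p ≤ riesz z p := by
  -- The tangent may have degree 1, which is where `1 ≤ k` is needed.
  have h := riesz_nonneg_of_isSOSIn hz (isSOSIn_taylorRem hp hc x)
    ((totalDegree_taylorRem_le x p).trans (max_le hd (by omega)))
  have hC : ∀ c, rieszLin z (C c) = c := by
    intro c
    rw [← mul_one (C c), ← smul_eq_C_mul, map_smul, rieszLin_apply, h0, smul_eq_mul, mul_one]
  have hlin : rieszLin z (∑ s, C (eval x (pderiv s p)) * (X s - C (x s))) = 0 := by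
    rw [map_sum]
    refine Finset.sum_eq_zero fun s _ => ?_
    by_cases hs : s ∈ Δ
    · rw [← smul_eq_C_mul, map_smul, map_sub, hC, rieszLin_apply, hx s hs, sub_self, smul_zero]
    · rw [pderiv_eq_zero_of_mem_supported hp hs, map_zero, map_zero, zero_mul, map_zero]
  rw [← rieszLin_apply, taylorRem_apply, map_sub, map_sub, hlin, hC, rieszLin_apply] at h
  linarith

end Riesz

/-! ### The sparse problem: degrees of the summands -/

section POP

variable {m : ℕ} {P : SparseMatPOP n m}

open SparseMatPOP

theorem totalDegree_f_le {k : ℕ} (hk : P.k₀ ≤ k) : P.f.totalDegree ≤ 2 * k := by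
  have := (le_max_left _ _).trans hk
  omega

theorem matDeg_le {k : ℕ} (hk : P.k₀ ≤ k) (i : Fin m) : matDeg (P.G i) ≤ 2 * k := by
  have h1 := (le_max_right _ _).trans hk
  have h2 := (Finset.le_sup (f := fun i => (matDeg (P.G i) + 1) / 2) (Finset.mem_univ i)).trans h1
  omega

/-- SOS-convexity prevents cancellation between the summands of the objective. -/
theorem totalDegree_fs_le {k : ℕ} (hk : P.k₀ ≤ k) (h1 : 1 ≤ k) (hf : ∀ i, IsSOSConvex (P.fs i))
    (i : Fin m) : (P.fs i).totalDegree ≤ 2 * k := by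
  -- The order bounds the degree of `f` only. Joining the squares of all the blocks (base point 0,
  -- an arbitrary choice) turns this into a bound for each summand.
  choose r q hq using fun i => exists_taylorRem_eq_sum_sq (hf i) 0
  have hsum : taylorRem 0 P.f = ∑ x : (Σ i, Fin (r i)), q x.1 x.2 ^ 2 := by
    rw [Fintype.sum_sigma, f, map_sum]
    exact Finset.sum_congr rfl fun i _ => hq i
  have hdeg : (∑ x : (Σ i, Fin (r i)), q x.1 x.2 ^ 2).totalDegree ≤ 2 * k := by
    rw [← hsum]
    exact (totalDegree_taylorRem_le _ _).trans (max_le (totalDegree_f_le hk) (by omega))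
  have hle := totalDegree_le_of_sum_sq _ _ hdeg
  refine (totalDegree_le_taylorRem 0 _).trans (max_le ?_ (by omega))
  rw [hq]
  refine totalDegree_finsetSum_le fun j _ => (totalDegree_pow _ _).trans ?_
  have := hle ⟨i, j⟩ (Finset.mem_univ _)
  simp only at this
  omega

theorem fmin_eq {u : Fin n → ℝ} (hu : P.IsMinimizer u) : P.fmin = eval u P.f :=
  IsLeast.csInf_eq ⟨⟨u, hu.1, rfl⟩, by rintro _ ⟨x, hx, rfl⟩; exact hu.2 x hx⟩

theorem mem_K_iff {x : Fin n → ℝ} : x ∈ P.K ↔ ∀ i ξ, 0 ≤ eval x (quadForm (P.G i) ξ) :=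
  forall_congr' fun i => posSemidef_map_eval_iff (P.G_symm i) x

theorem isSOSConvex_neg_quadForm (hG : ∀ i, IsSOSConcaveMat (P.G i)) (i : Fin m)
    (ξ : Fin (P.ℓ i) → ℝ) : IsSOSConvex (-quadForm (P.G i) ξ) := by
  rw [← quadForm_neg]
  exact hG i ξ

/-! ### The moment relaxation -/

/-- The moment sequence of a point. -/
def pointMoments (P : SparseMatPOP n m) (k : ℕ) (x : Fin n → ℝ) : P.U k → ℝ :=
  fun α => eval x (monomial α.1 1)

theorem riesz_sub_eq_sum {k : ℕ} (y : P.U k → ℝ) (i : Fin m) {p : MvPolynomial (Fin n) ℝ}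
    (hp : p ∈ supported ℝ (P.Δ i : Set (Fin n))) :
    riesz (sub y i) p = ∑ α : P.U k, coeff α.1 p * y α := by
  have h1 := Finset.sum_attach (P.U k) fun α =>
    coeff α p * (if h : α ∈ P.U k then y ⟨α, h⟩ else 0)
  have h2 := Finset.sum_attach (monPowers (P.Δ i) (2 * k)) fun α =>
    coeff α p * (if h : α ∈ P.U k then y ⟨α, h⟩ else 0)
  have h3 : riesz (sub y i) p = ∑ α ∈ monPowers (P.Δ i) (2 * k),
      coeff α p * (if h : α ∈ P.U k then y ⟨α, h⟩ else 0) := by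
    rw [← h2]
    refine Finset.sum_congr rfl fun α _ => ?_
    rw [dif_pos (mem_U_of_mem i α.2)]
    rfl
  have h4 : ∑ α : P.U k, coeff α.1 p * y α = ∑ α ∈ P.U k,
      coeff α p * (if h : α ∈ P.U k then y ⟨α, h⟩ else 0) := by
    rw [← h1]
    refine Finset.sum_congr rfl fun α _ => ?_
    rw [dif_pos α.2]
  rw [h3, h4]
  refine Finset.sum_subset (fun α hα => mem_U_of_mem i hα) fun α hα hα' => ?_
  rw [notMem_support_iff.1 fun hs => hα' ?_, zero_mul]
  obtain ⟨i', -, hi'⟩ := Finset.mem_biUnion.1 hα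
  refine mem_monPowers.2 ⟨fun s hsα => ?_, (mem_monPowers.1 hi').2⟩
  have := mem_supported.1 hp ((mem_vars_iff_mem_support _).2 ⟨α, hs, hsα⟩)
  exact_mod_cast this

/-- The objective depends on `f` alone. This handles `k = 0`, where `f` is constant although affine
summands may cancel, so that truncation can lose terms of the single `f_i`. -/
theorem momObj_eq_sum {k : ℕ} (y : P.U k → ℝ) :
    momObj y = ∑ α : P.U k, coeff α.1 P.f * y α := by
  rw [momObj, Finset.sum_congr rfl fun i _ => riesz_sub_eq_sum y i (P.fs_mem i), Finset.sum_comm]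
  refine Finset.sum_congr rfl fun α _ => ?_
  rw [f, coeff_sum, Finset.sum_mul]

theorem f_eq_C_of_k₀ (h : P.k₀ ≤ 0) : P.f = C (coeff 0 P.f) :=
  totalDegree_eq_zero_iff_eq_C.1 (Nat.le_zero.1 (totalDegree_f_le h))

theorem momObj_eq_of_f_eq_C {k : ℕ} {y : P.U k → ℝ} (hy : y ⟨0, zero_mem_U k⟩ = 1) {c : ℝ}
    (hf : P.f = C c) : momObj y = c := by
  rw [momObj_eq_sum, Finset.sum_eq_single ⟨0, zero_mem_U k⟩]
  · simp [hf, hy]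
  · intro α _ hα
    rw [hf, coeff_C, if_neg fun h => hα (Subtype.ext h.symm), zero_mul]
  · simp

theorem pointMoments_zero (k : ℕ) (x : Fin n → ℝ) :
    pointMoments P k x ⟨0, zero_mem_U k⟩ = 1 := by
  simp [pointMoments]

theorem momObj_pointMoments {k : ℕ} (hk : P.k₀ ≤ k) (hf : ∀ i, IsSOSConvex (P.fs i))
    (x : Fin n → ℝ) : momObj (pointMoments P k x) = eval x P.f := by
  rcases Nat.eq_zero_or_pos k with rfl | h1
  · rw [momObj_eq_of_f_eq_C (pointMoments_zero 0 x) (f_eq_C_of_k₀ hk)]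
    conv_rhs => rw [f_eq_C_of_k₀ hk, eval_C]
  · rw [momObj, f, map_sum]
    exact Finset.sum_congr rfl fun i _ => riesz_eval x (P.fs_mem i) (totalDegree_fs_le hk h1 hf i)

theorem monomial_mem_supported {Δ : Finset (Fin n)} {d : ℕ} (α : monPowers Δ d) (c : ℝ) :
    monomial α.1 c ∈ supported ℝ (Δ : Set (Fin n)) := by
  rw [mem_supported]
  intro i hi
  have h1 := (mem_vars_iff_mem_support _).1 hi
  obtain ⟨β, hβ, hiβ⟩ := h1
  have := support_monomial_subset hβ
  rw [Finset.mem_singleton] at this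
  subst this
  exact_mod_cast (mem_monPowers.1 α.2).1 hiβ

theorem totalDegree_monomial_le_of_mem {Δ : Finset (Fin n)} {d : ℕ} (α : monPowers Δ d) :
    (monomial α.1 (1 : ℝ)).totalDegree ≤ d := by
  rw [totalDegree_monomial _ one_ne_zero]
  exact (mem_monPowers.1 α.2).2

theorem locBlock_point {Δ : Finset (Fin n)} {d s : ℕ} (x : Fin n → ℝ)
    {p : MvPolynomial (Fin n) ℝ} (hp : p ∈ supported ℝ (Δ : Set (Fin n)))
    (hd : p.totalDegree + 2 * s ≤ d) (α β : monPowers Δ s) :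
    locBlock s (fun α : monPowers Δ d => eval x (monomial α.1 1)) p α β =
      eval x p * (eval x (monomial α.1 1) * eval x (monomial β.1 1)) := by
  rw [locBlock, Matrix.of_apply, riesz_eval, map_mul, map_mul]
  · exact mul_mem hp (mul_mem (monomial_mem_supported α 1) (monomial_mem_supported β 1))
  · have h1 := totalDegree_mul p (monomial α.1 1 * monomial β.1 1)
    have h2 := totalDegree_mul (monomial α.1 (1 : ℝ)) (monomial β.1 1)
    have h3 := totalDegree_monomial_le_of_mem α
    have h4 := totalDegree_monomial_le_of_mem β
    omega

theorem pointMoments_mem {k : ℕ} (hk : P.k₀ ≤ k) {x : Fin n → ℝ} (hx : x ∈ P.K) :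
    pointMoments P k x ∈ P.momFeasible k := by
  refine ⟨fun i => ?_, fun i => ?_, pointMoments_zero k x⟩
  · have hent : ∀ u v, localizingMatrix k (P.G i) (sub (pointMoments P k x) i) u v =
        eval x (P.G i u.1 v.1) * (eval x (monomial u.2.1 1) * eval x (monomial v.2.1 1)) := by
      intro u v
      refine locBlock_point x (P.G_mem i _ _) ?_ _ _
      have h1 := totalDegree_le_matDeg (P.G i) u.1 v.1
      -- The subtraction in the size of the localizing matrix is truncated, so this bound is needed.
      have h2 := matDeg_le hk i
      omega
    refine Matrix.PosSemidef.of_dotProduct_mulVec_nonneg ?_ fun w => ?_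
    · ext u v
      rw [Matrix.conjTranspose_apply, hent, hent, (P.G_symm i).apply, star_trivial]
      ring
    · have h := mem_K_iff.1 hx i fun a => ∑ α, w (a, α) * eval x (monomial α.1 1)
      refine h.trans_eq ?_
      rw [eval_quadForm]
      simp only [Finset.sum_mul_sum, dotProduct, Matrix.mulVec, star_trivial, hent,
        Fintype.sum_prod_type]
      simp only [Finset.mul_sum]
      refine Finset.sum_congr rfl fun a _ => ?_
      rw [Finset.sum_comm]
      refine Finset.sum_congr rfl fun α _ => Finset.sum_congr rfl fun b _ =>
        Finset.sum_congr rfl fun β _ => ?_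
      ring
  · have hent : ∀ u v, momentMatrix k (sub (pointMoments P k x) i) u v =
        eval x (monomial u.1 1) * eval x (monomial v.1 1) := by
      intro u v
      have h := locBlock_point (d := 2 * k) x (one_mem (supported ℝ (P.Δ i : Set (Fin n))))
        (by rw [totalDegree_one, zero_add]) u v
      rw [map_one, one_mul] at h
      exact h
    refine Matrix.PosSemidef.of_dotProduct_mulVec_nonneg ?_ fun w => ?_
    · ext u v
      rw [Matrix.conjTranspose_apply, hent, hent, star_trivial, mul_comm]
    · refine (sq_nonneg (∑ α, w α * eval x (monomial α.1 1))).trans_eq ?_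
      rw [sq, Finset.sum_mul_sum]
      simp only [dotProduct, Matrix.mulVec, star_trivial, hent, Finset.mul_sum]
      exact Finset.sum_congr rfl fun α _ => Finset.sum_congr rfl fun β _ => by ring

/-- Test the localizing matrix on vectors supported on the constant monomial. -/
theorem riesz_quadForm_nonneg {Δ : Finset (Fin n)} {k l : ℕ}
    {G : Matrix (Fin l) (Fin l) (MvPolynomial (Fin n) ℝ)} {z : monPowers Δ (2 * k) → ℝ}
    (hz : (localizingMatrix k G z).PosSemidef) (ξ : Fin l → ℝ) : 0 ≤ riesz z (quadForm G ξ) := by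
  set o : monPowers Δ ((2 * k - matDeg G) / 2) := ⟨0, mem_monPowers.2 (by simp)⟩ with ho
  have h := hz.dotProduct_mulVec_nonneg fun u => if u.2 = o then ξ u.1 else 0
  refine h.trans_eq ?_
  have hent : ∀ a b, localizingMatrix k G z (a, o) (b, o) = riesz z (G a b) := by
    intro a b
    simp [localizingMatrix, locBlock, ho]
  rw [← rieszLin_apply, quadForm]
  simp only [dotProduct, Matrix.mulVec, star_trivial, Fintype.sum_prod_type, ite_mul, zero_mul,
    mul_ite, mul_zero, Finset.sum_ite_eq', Finset.mem_univ, if_true, map_sum,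
    ← smul_eq_C_mul, map_smul, Finset.mul_sum, smul_eq_mul, rieszLin_apply]
  refine Finset.sum_congr rfl fun a _ => ?_
  rw [Finset.sum_comm]
  refine Finset.sum_congr rfl fun b _ => ?_
  rw [Finset.sum_ite_eq' Finset.univ o, if_pos (Finset.mem_univ o), hent]
  ring

theorem riesz_sub_one {k : ℕ} {y : P.U k → ℝ} (hy : y ⟨0, zero_mem_U k⟩ = 1) (i : Fin m) :
    riesz (sub y i) 1 = 1 := by
  have := riesz_monomial (sub y i) ⟨0, mem_monPowers.2 (by simp)⟩ 1
  rw [one_mul] at this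
  exact this.trans hy

theorem riesz_sub_X {k : ℕ} (hk : 1 ≤ k) (y : P.U k → ℝ) (i : Fin m) {s : Fin n}
    (hs : s ∈ P.Δ i) : riesz (sub y i) (X s) = firstMoments hk y s := by
  have := riesz_monomial (sub y i) ⟨Finsupp.single s 1, mem_monPowers.2 ⟨
    Finsupp.support_single_subset.trans (Finset.singleton_subset_iff.mpr hs), by
      rw [Finsupp.degree_single]; omega⟩⟩ 1
  rw [one_mul] at this
  exact this

/-- Jensen's inequality for `-ξᵀG_iξ` gives `ξᵀG_i(x*)ξ ≥ ⟨ξᵀG_iξ, y⟩`, and the localizing matrix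
makes the right side nonnegative. -/
theorem firstMoments_mem_K {k : ℕ} (hk : P.k₀ ≤ k) (h1 : 1 ≤ k)
    (hG : ∀ i, IsSOSConcaveMat (P.G i)) {y : P.U k → ℝ} (hy : y ∈ P.momFeasible k) :
    firstMoments h1 y ∈ P.K := by
  refine mem_K_iff.2 fun i ξ => ?_
  have h := eval_le_riesz h1 (hy.2.1 i) (neg_mem (quadForm_mem (P.G_mem i) ξ))
    (by rw [totalDegree_neg]; exact (totalDegree_quadForm_le _ _).trans (matDeg_le hk i))
    (isSOSConvex_neg_quadForm hG i ξ) (riesz_sub_one hy.2.2 i) fun s hs => riesz_sub_X h1 y i hs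
  rw [map_neg, ← rieszLin_apply, map_neg, rieszLin_apply] at h
  linarith [riesz_quadForm_nonneg (hy.1 i) ξ]

theorem eval_firstMoments_le {k : ℕ} (hk : P.k₀ ≤ k) (h1 : 1 ≤ k)
    (hf : ∀ i, IsSOSConvex (P.fs i)) {y : P.U k → ℝ} (hy : y ∈ P.momFeasible k) :
    eval (firstMoments h1 y) P.f ≤ momObj y := by
  rw [f, map_sum, momObj]
  exact Finset.sum_le_sum fun i _ => eval_le_riesz h1 (hy.2.1 i) (P.fs_mem i)
    (totalDegree_fs_le hk h1 hf i) (hf i) (riesz_sub_one hy.2.2 i)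
    fun s hs => riesz_sub_X h1 y i hs

theorem fmin_le_momObj {k : ℕ} (hk : P.k₀ ≤ k) (hf : ∀ i, IsSOSConvex (P.fs i))
    (hG : ∀ i, IsSOSConcaveMat (P.G i)) {u : Fin n → ℝ} (hu : P.IsMinimizer u) {y : P.U k → ℝ}
    (hy : y ∈ P.momFeasible k) : P.fmin ≤ momObj y := by
  rw [fmin_eq hu]
  rcases Nat.eq_zero_or_pos k with rfl | h1
  · rw [momObj_eq_of_f_eq_C hy.2.2 (f_eq_C_of_k₀ hk)]
    conv_lhs => rw [f_eq_C_of_k₀ hk, eval_C]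
  · exact (hu.2 _ (firstMoments_mem_K hk h1 hG hy)).trans (eval_firstMoments_le hk h1 hf hy)

theorem fsmo_eq_fmin {k : ℕ} (hk : P.k₀ ≤ k) (hf : ∀ i, IsSOSConvex (P.fs i))
    (hG : ∀ i, IsSOSConcaveMat (P.G i)) {u : Fin n → ℝ} (hu : P.IsMinimizer u) :
    P.fsmo k = (P.fmin : EReal) := by
  refine le_antisymm ?_ (le_iInf₂ fun y hy => ?_)
  · refine (iInf₂_le _ (pointMoments_mem hk hu.1)).trans ?_
    rw [momObj_pointMoments hk hf, fmin_eq hu]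
  · exact EReal.coe_le_coe_iff.2 (fmin_le_momObj hk hf hG hu hy)

theorem isMinimizer_firstMoments {k : ℕ} (hk : P.k₀ ≤ k) (h1 : 1 ≤ k)
    (hf : ∀ i, IsSOSConvex (P.fs i)) (hG : ∀ i, IsSOSConcaveMat (P.G i)) {u : Fin n → ℝ}
    (hu : P.IsMinimizer u) {y : P.U k → ℝ} (hy : IsMomMinimizer y) :
    P.IsMinimizer (firstMoments h1 y) := by
  refine ⟨firstMoments_mem_K hk h1 hG hy.1, fun x hx => ?_⟩
  refine (eval_firstMoments_le hk h1 hf hy.1).trans ?_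
  refine (hy.2 _ (pointMoments_mem hk hu.1)).trans ?_
  rw [momObj_pointMoments hk hf]
  exact hu.2 x hx

/-! ### The SOS relaxation -/

theorem eval_nonneg_of_mem_qmTrunc {Δ : Finset (Fin n)} {k l : ℕ}
    {G : Matrix (Fin l) (Fin l) (MvPolynomial (Fin n) ℝ)} {q : MvPolynomial (Fin n) ℝ}
    (hq : q ∈ qmTrunc Δ G k) {x : Fin n → ℝ} (hx : (G.map (eval x)).PosSemidef) :
    0 ≤ eval x q := by
  obtain ⟨σ, ⟨-, hσ⟩, r, p, -, -, rfl⟩ := hq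
  rw [map_add, map_sum]
  refine add_nonneg (IsSOSIn.eval_nonneg hσ x) (Finset.sum_nonneg fun j _ => ?_)
  refine (hx.dotProduct_mulVec_nonneg fun a => eval x (p j a)).trans_eq ?_
  rw [dotProduct_mulVec_eq_sum]
  simp only [map_sum, map_mul, Matrix.map_apply]
  exact Finset.sum_congr rfl fun a _ => Finset.sum_congr rfl fun b _ => by ring

theorem le_eval_of_mem_qmSpa {k : ℕ} {γ : ℝ} (h : P.f - C γ ∈ P.qmSpa k) {x : Fin n → ℝ}
    (hx : x ∈ P.K) : γ ≤ eval x P.f := by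
  obtain ⟨r, hr, hsum⟩ := h
  have h1 := congrArg (eval x) hsum
  rw [map_sub, eval_C, map_sum] at h1
  have h2 : 0 ≤ ∑ i, eval x (r i) :=
    Finset.sum_nonneg fun i _ => eval_nonneg_of_mem_qmTrunc (hr i) (hx i)
  linarith

theorem exists_sos_multipliers (hf : ∀ i, IsSOSConvex (P.fs i))
    (hG : ∀ i, IsSOSConcaveMat (P.G i)) {u : Fin n → ℝ} (hu : P.IsMinimizer u) (hS : P.Slater) :
    ∃ B : ∀ i, Fin (P.ℓ i) → Fin (P.ℓ i) → ℝ, ∀ x,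
      ∑ i, ∑ j, eval x (quadForm (P.G i) (B i j)) ≤ eval x P.f - eval u P.f := by
  have hform : ∀ x i ξ, MatFamily.form i ξ (fun e : (Σ i, Fin (P.ℓ i) × Fin (P.ℓ i)) =>
      eval x (P.G e.1 e.2.1 e.2.2)) = eval x (quadForm (P.G i) ξ) := by
    intro x i ξ
    rw [eval_quadForm]
    rfl
  have := exists_lagrange_multipliers (F := fun x => eval x P.f - eval u P.f)
    (H := fun x e => eval x (P.G e.1 e.2.1 e.2.2)) ?_ ?_ ?_ ?_ ?_
  · simpa only [hform] using this
  · have h1 : ∀ t : Finset (Fin m), ConvexOn ℝ Set.univ fun x => ∑ i ∈ t, eval x (P.fs i) := by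
      intro t
      induction t using Finset.induction_on with
      | empty => simpa using convexOn_const (0 : ℝ) convex_univ
      | insert i t hi ih =>
        simp only [Finset.sum_insert hi]
        exact (convexOn_eval_of_isSOSConvex (hf i)).add ih
    have h2 := (h1 Finset.univ).add_const (-eval u P.f)
    simpa [f, sub_eq_add_neg, Pi.add_def] using h2
  · intro i ξ
    have := (convexOn_eval_of_isSOSConvex (isSOSConvex_neg_quadForm hG i ξ)).neg
    simpa [hform, Pi.neg_def] using this
  · intro x i a b
    simp only [(P.G_symm i).apply b a]
  · obtain ⟨x, hx⟩ := hS
    refine ⟨x, fun i ξ hξ => ?_⟩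
    rw [hform, eval_quadForm_eq_dotProduct]
    exact (hx i).dotProduct_mulVec_pos hξ
  · intro x hx
    simp only [hform] at hx
    linarith [hu.2 x (mem_K_iff.2 hx)]

theorem vecDeg_C {l : ℕ} (ξ : Fin l → ℝ) :
    vecDeg (fun a => (C (ξ a) : MvPolynomial (Fin n) ℝ)) = 0 := by
  simp [vecDeg]

theorem f_sub_fmin_mem_qmSpa {k : ℕ} (hk : P.k₀ ≤ k) (hf : ∀ i, IsSOSConvex (P.fs i))
    (hG : ∀ i, IsSOSConcaveMat (P.G i)) {u : Fin n → ℝ} (hu : P.IsMinimizer u) (hS : P.Slater) :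
    P.f - C P.fmin ∈ P.qmSpa k := by
  rw [fmin_eq hu]
  rcases Nat.eq_zero_or_pos k with rfl | h1
  -- For `k = 0` the objective is constant, and the zero certificate works.
  · refine ⟨0, fun i => ⟨0, ⟨by simp, 0, 0, by simp, by simp⟩, 0, 0, by simp, by simp, by simp⟩, ?_⟩
    rw [f_eq_C_of_k₀ hk]
    simp
  obtain ⟨B, hB⟩ := exists_sos_multipliers hf hG hu hS
  set R : Fin m → MvPolynomial (Fin n) ℝ := fun i =>
    taylorRem u (P.fs i) + ∑ j, taylorRem u (-quadForm (P.G i) (B i j)) with hR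
  set L : MvPolynomial (Fin n) ℝ := P.f - C (eval u P.f) - ∑ i, ∑ j, quadForm (P.G i) (B i j)
    with hL
  have hLeval : ∀ x, eval x L =
      eval x P.f - eval u P.f - ∑ i, ∑ j, eval x (quadForm (P.G i) (B i j)) := by
    intro x
    simp only [hL, map_sub, eval_C, map_sum]
  -- Complementary slackness: at the feasible point `u` the multiplier terms are nonnegative, and by
  -- `hB` their sum is at most 0.
  have hLu : eval u L = 0 := by
    have h2 : 0 ≤ ∑ i, ∑ j, eval u (quadForm (P.G i) (B i j)) :=
      Finset.sum_nonneg fun i _ => Finset.sum_nonneg fun j _ => mem_K_iff.1 hu.1 i _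
    have h3 := hB u
    rw [hLeval]
    linarith
  have hgrad : ∀ s, eval u (pderiv s L) = 0 := fun s => eval_pderiv_eq_zero_of_isMin (fun x => by
    rw [hLu, hLeval]
    linarith [hB x]) s
  -- Value and gradient of `L` vanish at `u`. This holds only for the whole Lagrangian; the tangents
  -- of the single blocks cancel only in the sum.
  have hrem : taylorRem u L = L := by
    rw [taylorRem_apply, hLu]
    simp [hgrad]
  have hremR : taylorRem u L = ∑ i, R i := by
    rw [hL, map_sub, map_sub, taylorRem_C, f]
    simp only [map_sum, hR, Finset.sum_add_distrib, map_neg, Finset.sum_neg_distrib]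
    ring
  refine ⟨fun i => R i + ∑ j, quadForm (P.G i) (B i j), fun i => ?_, ?_⟩
  -- The multiplier vectors are constant, so `deg G_i ≤ 2k` is the only degree condition on them.
  · refine ⟨R i, ⟨?_, ?_⟩, P.ℓ i, fun j a => C (B i j a), ?_, ?_, ?_⟩
    · refine (totalDegree_add _ _).trans (max_le ?_ (totalDegree_finsetSum_le fun j _ => ?_))
      · exact (totalDegree_taylorRem_le _ _).trans
          (max_le (totalDegree_fs_le hk h1 hf i) (by omega))
      · refine (totalDegree_taylorRem_le _ _).trans (max_le ?_ (by omega))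
        rw [totalDegree_neg]
        exact (totalDegree_quadForm_le _ _).trans (matDeg_le hk i)
    · exact (isSOSIn_taylorRem (P.fs_mem i) (hf i) u).add (IsSOSIn.sum fun j =>
        isSOSIn_taylorRem (neg_mem (quadForm_mem (P.G_mem i) _)) (isSOSConvex_neg_quadForm hG i _) u)
    · exact fun j a => Subalgebra.algebraMap_mem _ _
    · intro j
      rw [vecDeg_C, mul_zero, zero_add]
      exact matDeg_le hk i
    · change R i + ∑ j, ∑ a, ∑ b, C (B i j a * B i j b) * P.G i a b = _
      refine congrArg (R i + ·) ?_
      refine Finset.sum_congr rfl fun j _ => Finset.sum_congr rfl fun a _ =>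
        Finset.sum_congr rfl fun b _ => ?_
      rw [C_mul]
      ring
  · rw [Finset.sum_add_distrib, ← hremR, hrem, hL]
    ring

end POP

end SOSConvexity

end

open SOSConvexity in
theorem theorem5p2 {n m : ℕ} (P : SparseMatPOP n m)
    (hmin : ∃ u, P.IsMinimizer u)
    (hf : ∀ i, IsSOSConvex (P.fs i))
    (hG : ∀ i, IsSOSConcaveMat (P.G i)) :
    (∀ k, P.k₀ ≤ k →
      P.fsmo k = (P.fmin : EReal) ∧
      (P.Slater →
        P.fspa k = (P.fmin : EReal) ∧ P.f - MvPolynomial.C P.fmin ∈ P.qmSpa k)) ∧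
    (∀ (k : ℕ) (_ : P.k₀ ≤ k) (hk : 1 ≤ k) (y : P.U k → ℝ),
      SparseMatPOP.IsMomMinimizer y → P.IsMinimizer (SparseMatPOP.firstMoments hk y)) := by
  obtain ⟨u, hu⟩ := hmin
  refine ⟨fun k hk => ⟨fsmo_eq_fmin hk hf hG hu, fun hS => ?_⟩,
    fun k hk h1 y hy => isMinimizer_firstMoments hk h1 hf hG hu hy⟩
  have hmem := f_sub_fmin_mem_qmSpa hk hf hG hu hS
  refine ⟨le_antisymm (iSup₂_le fun γ hγ => ?_) (le_iSup₂_of_le P.fmin hmem le_rfl), hmem⟩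
  rw [fmin_eq hu]
  exact EReal.coe_le_coe_iff.2 (le_eval_of_mem_qmSpa hγ hu.1)
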